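/- Let $E_6\subset[0,1]$ be the set of all real numbers $$x=[0;a_1,a_2,a_3,\dots]=\cfrac{1}{a_1+\cfrac{1}{a_2+\cfrac{1}{a_3+\cdots}}}$$ given by infinite continued fractions whose digits satisfy $a_n\in\{1,2,3,4,5,6\}$ for every $n\ge 1$. Then the Hausdorff dimension of $E_6$ satisfies $$0.86761917324015-10^{-13}\;\le\;\dim_H E_6\;\le\;0.86761917324015+10^{-13}.$$ In particular $\dim_H E_6>\tfrac{19}{22}$. -/

import Mathlib

open Filter Topology

/-- The infinite regular continued fraction `[0; a 0, a 1, a 2, …]`, with integer part `0`,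
all partial numerators `1` and partial denominators `a 0, a 1, a 2, …`. -/
def digitContFract (a : ℕ → ℕ) : GenContFract ℝ where
  h := 0
  s := Stream'.Seq.ofStream (fun n => ⟨1, (a n : ℝ)⟩)

/-- `cantorE m` is the set of all values `[0; a₁, a₂, …]` (limits of convergents) of infinite
continued fractions whose digits all lie in `{1, …, m}`. -/
def cantorE (m : ℕ) : Set ℝ :=
  {x | ∃ a : ℕ → ℕ, (∀ n, 1 ≤ a n ∧ a n ≤ m) ∧
    Tendsto (fun n => (digitContFract a).convs n) atTop (𝓝 x)}

/-!
The set `cantorE 6` is the attractor of the contractions `x ↦ 1 / (k + 1 + x)`, `k < 6`. By bounded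
distortion, a positive function `f` with `∑ k, |φₖ'| ^ s * f ∘ φₖ ≤ f` bounds the sums of the `s`-th
powers of the diameters of the images under words of length `n`, uniformly in `n`, so the dimension
is at most `s`. The opposite inequality makes such sums at least `1` for long words at every smaller
exponent, and a Moran measure shows that the dimension is at least `s`.

At each end of the enclosure the required `f` is the same polynomial of degree 24, an approximation
to the eigenfunction of the transfer operator. Both sides of the functional inequality are expanded
around the midpoint `1 / 2` of an interval of radius `3 / 8`; the constant term of the difference
dominates the others, which is a finite computation with rational numbers.
-/

section ConformalIFS

open scoped NNReal ENNReal
open Function Set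

variable {ι X : Type*}

/-- The composition `φ (w (n - 1)) ∘ ⋯ ∘ φ (w 0)` of the maps spelled by a word `w`. -/
def wordMap (φ : ι → X → X) : (n : ℕ) → (Fin n → ι) → X → X
  | 0, _ => id
  | n + 1, w => wordMap φ n (Fin.tail w) ∘ φ (w 0)

/-- The weight of `wordMap φ n w`: the product of the weights `ρ` along the orbit, as in the chain
rule. -/
def wordWeight (φ : ι → X → X) (ρ : ι → X → ℝ) : (n : ℕ) → (Fin n → ι) → X → ℝ
  | 0, _, _ => 1
  | n + 1, w, x => wordWeight φ ρ n (Fin.tail w) (φ (w 0) x) * ρ (w 0) x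

/-- The Ruelle transfer operator of the maps `φ` with the weights `ρ` raised to the power `s`. -/
noncomputable def transfer [Fintype ι] (φ : ι → X → X) (ρ : ι → X → ℝ) (s : ℝ) (f : X → ℝ) (x : X) :
    ℝ :=
  ∑ i, ρ i x ^ s * f (φ i x)

variable {φ : ι → X → X} {ρ : ι → X → ℝ} {θ L : ℝ≥0}

theorem uncurry_wordMap_surjective (hφ : Surjective (uncurry φ)) (n : ℕ) :
    Surjective (uncurry (wordMap φ n)) := by
  induction n with
  | zero => exact fun x => ⟨(Fin.elim0, x), rfl⟩
  | succ n ih =>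
    intro z
    obtain ⟨⟨w, y⟩, rfl⟩ := ih z
    obtain ⟨⟨i, x⟩, rfl⟩ := hφ y
    exact ⟨(Fin.cons i w, x), by simp [wordMap]⟩

theorem uncurry_wordMap_injective (hφ : Injective (uncurry φ)) (n : ℕ) :
    Injective (uncurry (wordMap φ n)) := by
  induction n with
  | zero => exact fun p q h => Prod.ext (Subsingleton.elim _ _) h
  | succ n ih =>
    rintro ⟨v, x⟩ ⟨w, y⟩ h
    obtain ⟨htail, hxy⟩ := Prod.mk.inj (@ih (Fin.tail v, φ (v 0) x) (Fin.tail w, φ (w 0) y) h)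
    obtain ⟨h0, rfl⟩ := Prod.mk.inj (@hφ (v 0, x) (w 0, y) hxy)
    rw [← Fin.cons_self_tail v, ← Fin.cons_self_tail w, h0, htail]

variable [MetricSpace X]

/-- A conformal iterated function system: contractions `φ i` with ratio `θ`, where `φ i` scales
distances near `x` by the positive weight `ρ i x` (its derivative), up to a relative error which is
at most exponential in the distance, with rate `L`. -/
structure IsConformalIFS (φ : ι → X → X) (ρ : ι → X → ℝ) (θ L : ℝ≥0) : Prop where
  lipschitzWith (i : ι) : LipschitzWith θ (φ i)
  weight_pos (i : ι) (x : X) : 0 < ρ i x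
  weight_le (i : ι) (x : X) : ρ i x ≤ θ
  dist_map_le (i : ι) (x y : X) :
    dist (φ i x) (φ i y) ≤ Real.exp (L * dist x y) * ρ i x * dist x y
  le_dist_map (i : ι) (x y : X) :
    ρ i x * dist x y ≤ Real.exp (L * dist x y) * dist (φ i x) (φ i y)

namespace IsConformalIFS

theorem exp_mul_dist_map_le (h : IsConformalIFS φ ρ θ L) (M : ℝ≥0) (i : ι) (x y : X) :
    Real.exp (M * dist (φ i x) (φ i y)) ≤ Real.exp (M * θ * dist x y) := by
  rw [mul_assoc]
  gcongr
  exact (h.lipschitzWith i).dist_le_mul x y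

theorem comp {κ : Type*} {ψ : κ → X → X} {σ : κ → X → ℝ} {η M : ℝ≥0}
    (hψ : IsConformalIFS ψ σ η M) (hφ : IsConformalIFS φ ρ θ L) :
    IsConformalIFS (fun p : κ × ι => ψ p.1 ∘ φ p.2)
      (fun p x => σ p.1 (φ p.2 x) * ρ p.2 x) (η * θ) (L + M * θ) where
  lipschitzWith p := (hψ.lipschitzWith p.1).comp (hφ.lipschitzWith p.2)
  weight_pos p x := mul_pos (hψ.weight_pos _ _) (hφ.weight_pos _ _)
  weight_le p x := mul_le_mul (hψ.weight_le _ _) (hφ.weight_le _ _) (hφ.weight_pos _ _).le η.2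
  dist_map_le p x y := by
    have hσ := hψ.weight_pos p.1 (φ p.2 x)
    have hexp := hφ.exp_mul_dist_map_le M p.2 x y
    calc _ ≤ Real.exp (M * dist (φ p.2 x) (φ p.2 y)) * σ p.1 (φ p.2 x) *
          dist (φ p.2 x) (φ p.2 y) := hψ.dist_map_le _ _ _
      _ ≤ Real.exp (M * θ * dist x y) * σ p.1 (φ p.2 x) *
          (Real.exp (L * dist x y) * ρ p.2 x * dist x y) := by
        gcongr
        exact hφ.dist_map_le _ _ _
      _ = _ := by
        push_cast
        rw [add_mul, Real.exp_add]
        ring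
  le_dist_map p x y := by
    have hσ := hψ.weight_pos p.1 (φ p.2 x)
    have hexp := hφ.exp_mul_dist_map_le M p.2 x y
    calc _ = σ p.1 (φ p.2 x) * (ρ p.2 x * dist x y) := mul_assoc _ _ _
      _ ≤ σ p.1 (φ p.2 x) * (Real.exp (L * dist x y) * dist (φ p.2 x) (φ p.2 y)) := by
        exact mul_le_mul_of_nonneg_left (hφ.le_dist_map _ _ _) hσ.le
      _ = Real.exp (L * dist x y) * (σ p.1 (φ p.2 x) * dist (φ p.2 x) (φ p.2 y)) := by ring
      _ ≤ Real.exp (L * dist x y) * (Real.exp (M * θ * dist x y) *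
          dist (ψ p.1 (φ p.2 x)) (ψ p.1 (φ p.2 y))) := by
        refine mul_le_mul_of_nonneg_left ((hψ.le_dist_map _ _ _).trans ?_) (Real.exp_pos _).le
        exact mul_le_mul_of_nonneg_right hexp dist_nonneg
      _ = _ := by
        push_cast
        rw [add_mul, Real.exp_add, mul_assoc (Real.exp _), comp_apply, comp_apply]

theorem mono (h : IsConformalIFS φ ρ θ L) {M : ℝ≥0} (hLM : L ≤ M) : IsConformalIFS φ ρ θ M where
  __ := h
  dist_map_le i x y := (h.dist_map_le i x y).trans <| by
    have := (h.weight_pos i x).le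
    gcongr
  le_dist_map i x y := (h.le_dist_map i x y).trans <| by gcongr

/-- The distortion rate `M` is uniform in the length of the words because the rates of successive
maps act on geometrically shrinking distances. -/
theorem word (h : IsConformalIFS φ ρ θ L) {M : ℝ≥0} (hM : L + M * θ ≤ M) (n : ℕ) :
    IsConformalIFS (wordMap φ n) (wordWeight φ ρ n) (θ ^ n) M := by
  induction n with
  | zero =>
    have hexp (x y : X) : 1 ≤ Real.exp (M * dist x y) := Real.one_le_exp (by positivity)
    refine ⟨fun _ => by simpa [wordMap] using LipschitzWith.id, fun _ _ => one_pos,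
      fun _ _ => by simp [wordWeight], fun _ x y => ?_, fun _ x y => ?_⟩ <;>
    · simpa [wordMap, wordWeight] using le_mul_of_one_le_left dist_nonneg (hexp x y)
  | succ n ih =>
    have hcomp := (ih.comp h).mono hM
    exact ⟨fun w => hcomp.lipschitzWith (Fin.tail w, w 0), fun w => hcomp.weight_pos (_, w 0),
      fun w => hcomp.weight_le (_, w 0), fun w => hcomp.dist_map_le (_, w 0),
      fun w => hcomp.le_dist_map (_, w 0)⟩

theorem weight_le_exp_mul_weight (h : IsConformalIFS φ ρ θ L) (i : ι) (x y : X) :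
    ρ i x ≤ Real.exp (2 * (L * dist x y)) * ρ i y := by
  rcases eq_or_ne x y with rfl | hxy
  · simp
  refine le_of_mul_le_mul_right ?_ (dist_pos.2 hxy)
  calc ρ i x * dist x y ≤ Real.exp (L * dist x y) * dist (φ i y) (φ i x) := by
        rw [dist_comm (φ i y)]
        exact h.le_dist_map i x y
    _ ≤ Real.exp (L * dist x y) * (Real.exp (L * dist x y) * ρ i y * dist x y) := by
        rw [dist_comm x y]
        gcongr
        exact h.dist_map_le i y x
    _ = _ := by
        rw [two_mul, Real.exp_add]
        ring

section BoundedDistortion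

variable [BoundedSpace X]

theorem weight_le_exp_diam_mul_weight (h : IsConformalIFS φ ρ θ L) (i : ι) (x y : X) :
    ρ i x ≤ Real.exp (2 * (L * Metric.diam (univ : Set X))) * ρ i y := by
  refine (h.weight_le_exp_mul_weight i x y).trans ?_
  have := (h.weight_pos i y).le
  gcongr
  exact Metric.dist_le_diam_of_mem (Bornology.isBounded_univ.2 ‹_›) (mem_univ x) (mem_univ y)

theorem dist_map_le_exp_diam (h : IsConformalIFS φ ρ θ L) (i : ι) (x y z : X) :
    dist (φ i x) (φ i y) ≤
      Real.exp (3 * (L * Metric.diam (univ : Set X))) * ρ i z * dist x y := by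
  have hD : dist x y ≤ Metric.diam (univ : Set X) :=
    Metric.dist_le_diam_of_mem (Bornology.isBounded_univ.2 ‹_›) (mem_univ x) (mem_univ y)
  calc _ ≤ Real.exp (L * dist x y) * ρ i x * dist x y := h.dist_map_le i x y
    _ ≤ Real.exp (L * Metric.diam (univ : Set X)) *
        (Real.exp (2 * (L * Metric.diam (univ : Set X))) * ρ i z) * dist x y := by
      have := (h.weight_pos i x).le
      gcongr
      exact h.weight_le_exp_diam_mul_weight i x z
    _ = _ := by
      rw [← mul_assoc, ← Real.exp_add]
      ring_nf

theorem le_dist_map_exp_diam (h : IsConformalIFS φ ρ θ L) (i : ι) (x y z : X) :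
    Real.exp (-(3 * (L * Metric.diam (univ : Set X)))) * ρ i z * dist x y ≤
      dist (φ i x) (φ i y) := by
  have hD : dist x y ≤ Metric.diam (univ : Set X) :=
    Metric.dist_le_diam_of_mem (Bornology.isBounded_univ.2 ‹_›) (mem_univ x) (mem_univ y)
  rw [Real.exp_neg, mul_assoc, inv_mul_le_iff₀ (Real.exp_pos _)]
  calc ρ i z * dist x y
      ≤ Real.exp (2 * (L * Metric.diam (univ : Set X))) * (ρ i x * dist x y) := by
        rw [← mul_assoc]
        gcongr
        exact h.weight_le_exp_diam_mul_weight i z x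
    _ ≤ Real.exp (2 * (L * Metric.diam (univ : Set X))) *
        (Real.exp (L * Metric.diam (univ : Set X)) * dist (φ i x) (φ i y)) := by
        refine mul_le_mul_of_nonneg_left ((h.le_dist_map i x y).trans ?_) (Real.exp_pos _).le
        gcongr
    _ = _ := by
        rw [← mul_assoc, ← Real.exp_add]
        ring_nf

end BoundedDistortion

section Transfer

variable [Fintype ι]

theorem transfer_mono (h : IsConformalIFS φ ρ θ L) (s : ℝ) : Monotone (transfer φ ρ s) :=
  fun _ _ hfg x => Finset.sum_le_sum fun i _ =>
    mul_le_mul_of_nonneg_left (hfg _) (Real.rpow_nonneg (h.weight_pos i x).le s)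

theorem transfer_word (h : IsConformalIFS φ ρ θ L) {M : ℝ≥0} (hM : L + M * θ ≤ M) (s : ℝ)
    (f : X → ℝ) (n : ℕ) :
    transfer (wordMap φ n) (wordWeight φ ρ n) s f = (transfer φ ρ s)^[n] f := by
  induction n with
  | zero =>
    ext x
    simp [transfer, wordMap, wordWeight]
  | succ n ih =>
    rw [iterate_succ_apply', ← ih]
    ext x
    simp only [transfer, Finset.mul_sum]
    rw [← (Fin.consEquiv fun _ => ι).sum_comp, Fintype.sum_prod_type]
    refine Finset.sum_congr rfl fun i _ => Finset.sum_congr rfl fun w _ => ?_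
    have htail : Fin.tail (Fin.consEquiv (fun _ => ι) (i, w)) = w := Fin.tail_cons _ _
    simp only [wordWeight, wordMap, htail, Fin.consEquiv_apply, Fin.cons_zero, comp_apply]
    rw [Real.mul_rpow ((h.word hM n).weight_pos _ _).le (h.weight_pos _ _).le]
    ring

theorem transfer_word_le (h : IsConformalIFS φ ρ θ L) {M : ℝ≥0} (hM : L + M * θ ≤ M) {s : ℝ}
    {f : X → ℝ} (hf : transfer φ ρ s f ≤ f) (n : ℕ) :
    transfer (wordMap φ n) (wordWeight φ ρ n) s f ≤ f := by
  rw [h.transfer_word hM]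
  exact (h.transfer_mono s).antitone_iterate_of_map_le hf n.zero_le

theorem le_transfer_word (h : IsConformalIFS φ ρ θ L) {M : ℝ≥0} (hM : L + M * θ ≤ M) {s : ℝ}
    {f : X → ℝ} (hf : f ≤ transfer φ ρ s f) (n : ℕ) :
    f ≤ transfer (wordMap φ n) (wordWeight φ ρ n) s f := by
  rw [h.transfer_word hM]
  exact (h.transfer_mono s).monotone_iterate_of_le_map hf n.zero_le

end Transfer

theorem exists_wordRate (hθ : θ < 1) (L : ℝ≥0) : ∃ M : ℝ≥0, L + M * θ ≤ M := by
  refine ⟨L / (1 - θ), le_of_eq ?_⟩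
  calc L + L / (1 - θ) * θ = L / (1 - θ) * (1 - θ) + L / (1 - θ) * θ := by
        rw [div_mul_cancel₀ _ (tsub_pos_of_lt hθ).ne']
    _ = L / (1 - θ) := by rw [← mul_add, tsub_add_cancel_of_le hθ.le, mul_one]

theorem ediam_range_le [BoundedSpace X] (h : IsConformalIFS φ ρ θ L) (i : ι) (x : X) :
    Metric.ediam (range (φ i)) ≤ ENNReal.ofReal
      (Real.exp (3 * (L * Metric.diam (univ : Set X))) * Metric.diam (univ : Set X) * ρ i x) := by
  refine Metric.ediam_le ?_
  rintro _ ⟨y, rfl⟩ _ ⟨z, rfl⟩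
  rw [edist_dist]
  refine ENNReal.ofReal_le_ofReal ((h.dist_map_le_exp_diam i y z x).trans ?_)
  have := (h.weight_pos i x).le
  rw [mul_right_comm]
  gcongr
  exact Metric.dist_le_diam_of_mem (Bornology.isBounded_univ.2 ‹_›) (mem_univ y) (mem_univ z)

theorem sum_weight_rpow_le [Fintype ι] (h : IsConformalIFS φ ρ θ L) {s c : ℝ} {f : X → ℝ}
    (hc : 0 < c) (hcf : ∀ x, c ≤ f x) (hf : transfer φ ρ s f ≤ f) (x : X) :
    ∑ i, ρ i x ^ s ≤ f x / c := by
  rw [le_div_iff₀ hc, Finset.sum_mul]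
  refine le_trans (Finset.sum_le_sum fun i _ => ?_) (hf x)
  exact mul_le_mul_of_nonneg_left (hcf _) (Real.rpow_nonneg (h.weight_pos i x).le s)

theorem le_sum_weight_rpow [Fintype ι] (h : IsConformalIFS φ ρ θ L) {s C : ℝ} {f : X → ℝ}
    (hC : 0 < C) (hfC : ∀ x, f x ≤ C) (hf : f ≤ transfer φ ρ s f) (x : X) :
    f x / C ≤ ∑ i, ρ i x ^ s := by
  rw [div_le_iff₀ hC, Finset.sum_mul]
  refine (hf x).trans (Finset.sum_le_sum fun i _ => ?_)
  exact mul_le_mul_of_nonneg_left (hfC _) (Real.rpow_nonneg (h.weight_pos i x).le s)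

theorem sum_ediam_range_rpow_le [Fintype ι] [BoundedSpace X] (h : IsConformalIFS φ ρ θ L)
    {s : ℝ≥0} (x : X) : ∑ i, Metric.ediam (range (φ i)) ^ (s : ℝ) ≤ ENNReal.ofReal
      ((Real.exp (3 * (L * Metric.diam (univ : Set X))) * Metric.diam (univ : Set X)) ^ (s : ℝ) *
        ∑ i, ρ i x ^ (s : ℝ)) := by
  set C := Real.exp (3 * (L * Metric.diam (univ : Set X))) * Metric.diam (univ : Set X)
  have hC : 0 ≤ C := by positivity
  have hρ (i : ι) : 0 ≤ ρ i x := (h.weight_pos i x).le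
  calc _ ≤ ∑ i, ENNReal.ofReal (C ^ (s : ℝ) * ρ i x ^ (s : ℝ)) := by
        refine Finset.sum_le_sum fun i _ => ?_
        rw [← Real.mul_rpow hC (hρ i),
          ← ENNReal.ofReal_rpow_of_nonneg (mul_nonneg hC (hρ i)) s.coe_nonneg]
        exact ENNReal.rpow_le_rpow (h.ediam_range_le i x) s.coe_nonneg
    _ = _ := by
        rw [← ENNReal.ofReal_sum_of_nonneg, ← Finset.mul_sum]
        exact fun i _ => mul_nonneg (Real.rpow_nonneg hC _) (Real.rpow_nonneg (hρ i) _)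

theorem ediam_range_le_ratio (h : IsConformalIFS φ ρ θ L) (i : ι) :
    Metric.ediam (range (φ i)) ≤ θ * Metric.ediam (univ : Set X) := by
  rw [← image_univ]
  exact (h.lipschitzWith i).ediam_image_le univ

/-- A positive supersolution of the transfer operator bounds the sums over the covers by the images
of the `n`-letter words uniformly in `n`. -/
theorem dimH_univ_le [CompactSpace X] [Fintype ι] (h : IsConformalIFS φ ρ θ L) (hθ : θ < 1)
    (hφ : Surjective (uncurry φ)) {s : ℝ≥0} {f : X → ℝ} (hf : Continuous f)
    (hf_pos : ∀ x, 0 < f x) (hfs : transfer φ ρ s f ≤ f) : dimH (univ : Set X) ≤ s := by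
  borelize X
  rcases isEmpty_or_nonempty X with hX | ⟨⟨x₀⟩⟩
  · simp [univ_eq_empty_iff.2 hX]
  obtain ⟨x₁, -, hmin⟩ := isCompact_univ.exists_isMinOn ⟨x₀, mem_univ _⟩ hf.continuousOn
  obtain ⟨M, hM⟩ := exists_wordRate hθ L
  set C : ℝ := Real.exp (3 * (M * Metric.diam (univ : Set X))) * Metric.diam (univ : Set X)
  have hsum (n : ℕ) : ∑ w, Metric.ediam (range (wordMap φ n w)) ^ (s : ℝ) ≤
      ENNReal.ofReal (C ^ (s : ℝ) * (f x₀ / f x₁)) := by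
    refine ((h.word hM n).sum_ediam_range_rpow_le x₀).trans (ENNReal.ofReal_le_ofReal ?_)
    gcongr
    exact (h.word hM n).sum_weight_rpow_le (hf_pos x₁) (fun x => hmin (mem_univ x))
      (h.transfer_word_le hM hfs n) x₀
  have hdiam : Tendsto (fun n : ℕ => (θ ^ n : ℝ≥0) * Metric.ediam (univ : Set X)) atTop (𝓝 0) := by
    have hθn := ENNReal.tendsto_coe.2 (NNReal.tendsto_pow_atTop_nhds_zero_of_lt_one hθ)
    simpa using ENNReal.Tendsto.mul_const hθn (Or.inr Metric.isBounded_of_compactSpace.ediam_ne_top)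
  refine dimH_le_of_hausdorffMeasure_ne_top (ne_top_of_le_ne_top ENNReal.ofReal_ne_top
    ((MeasureTheory.Measure.hausdorffMeasure_le_liminf_sum (s : ℝ) univ (l := atTop) _ hdiam
      (fun n (w : Fin n → ι) => range (wordMap φ n w)) ?_ ?_).trans
      (liminf_le_of_frequently_le (Frequently.of_forall hsum))))
  · exact Eventually.of_forall fun n w => (h.word hM n).ediam_range_le_ratio w
  · refine Eventually.of_forall fun n z _ => mem_iUnion.2 ?_
    obtain ⟨⟨w, x⟩, rfl⟩ := uncurry_wordMap_surjective hφ n z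
    exact ⟨w, x, rfl⟩

end IsConformalIFS

end ConformalIFS

section Moran

open scoped NNReal ENNReal
open Function Set MeasureTheory

theorem le_dimH_of_mul_measure_le {X : Type*} [EMetricSpace X] [MeasurableSpace X] [BorelSpace X]
    {ν : Measure X} {A : Set X} (hA : ν A ≠ 0) {c : ℝ≥0∞} (hc : c ≠ 0) {s : ℝ≥0}
    (hν : ∀ S, IsClosed S → c * ν S ≤ Metric.ediam S ^ (s : ℝ)) : (s : ℝ≥0∞) ≤ dimH A := by
  have hle : c • ν ≤ Measure.hausdorffMeasure (s : ℝ) := by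
    refine Measure.le_hausdorffMeasure _ _ 1 one_pos fun S _ => ?_
    rw [← Metric.ediam_closure S]
    exact (measure_mono subset_closure).trans (hν _ isClosed_closure)
  refine le_dimH_of_hausdorffMeasure_ne_zero (ne_bot_of_le_ne_bot ?_ (hle A))
  exact mul_ne_zero hc hA

theorem exists_isProbabilityMeasure_singleton_le {ι : Type*} [Fintype ι] [MeasurableSpace ι]
    [MeasurableSingletonClass ι] {a : ι → ℝ≥0} (ha : 1 ≤ ∑ i, a i) :
    ∃ μ : Measure ι, IsProbabilityMeasure μ ∧ ∀ i, μ {i} ≤ a i := by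
  have hsum : ∑' i, (a i : ℝ≥0∞) = (∑ i, a i : ℝ≥0) := by
    rw [tsum_fintype, ENNReal.ofNNReal_finsetSum]
  have hsum0 : ∑' i, (a i : ℝ≥0∞) ≠ 0 := by
    rw [hsum, ENNReal.coe_ne_zero]
    exact (one_pos.trans_le ha).ne'
  let p := PMF.normalize (fun i => (a i : ℝ≥0∞)) hsum0 (hsum ▸ ENNReal.coe_ne_top)
  refine ⟨p.toMeasure, inferInstance, fun i => ?_⟩
  rw [PMF.toMeasure_apply_singleton _ _ (measurableSet_singleton i), PMF.normalize_apply, hsum]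
  exact mul_le_of_le_one_right' (ENNReal.inv_le_one.2 (by exact_mod_cast ha))

section Coding

variable {ι X : Type*}

theorem infinitePi_cylinder [MeasurableSpace ι] [MeasurableSingletonClass ι] (μ : Measure ι)
    [IsProbabilityMeasure μ] (ω : ℕ → ι) (n : ℕ) :
    Measure.infinitePi (fun _ : ℕ => μ) (PiNat.cylinder ω n) =
      ∏ i ∈ Finset.range n, μ {ω i} := by
  rw [← Measure.infinitePi_pi (μ := fun _ : ℕ => μ) (s := Finset.range n)
    (t := fun i => {ω i}) fun i _ => measurableSet_singleton _]
  congr 1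
  ext ω'
  simp [PiNat.cylinder]

theorem exists_subset_cylinder_of_nontrivial {A : Set (ℕ → ι)} (hA : A.Nontrivial) :
    ∃ ω ∈ A, ∃ ω' ∈ A, ∃ n, ω' n ≠ ω n ∧ A ⊆ PiNat.cylinder ω n := by
  classical
  obtain ⟨ω, hω, ω₁, hω₁, hne⟩ := hA
  have hex : ∃ n, ∃ ω' ∈ A, ω' n ≠ ω n :=
    (ne_iff.1 hne.symm).imp fun n hn => ⟨ω₁, hω₁, hn⟩
  obtain ⟨ω', hω', hn⟩ := Nat.find_spec hex
  refine ⟨ω, hω, ω', hω', Nat.find hex, hn, fun τ hτ i hi => ?_⟩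
  by_contra hne
  exact Nat.find_min hex hi ⟨τ, hτ, hne⟩

section ProductMeasure

variable [MeasurableSpace ι] [MeasurableSingletonClass ι] {r : ι → ℝ≥0} {s : ℝ≥0} {μ : Measure ι}
  [IsProbabilityMeasure μ]

theorem infinitePi_cylinder_le (hμ : ∀ i, μ {i} ≤ (r i ^ (s : ℝ) : ℝ≥0)) (ω : ℕ → ι) (n : ℕ) :
    Measure.infinitePi (fun _ : ℕ => μ) (PiNat.cylinder ω n) ≤
      ((∏ i ∈ Finset.range n, r (ω i) : ℝ≥0) : ℝ≥0∞) ^ (s : ℝ) := by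
  rw [infinitePi_cylinder, ← ENNReal.coe_rpow_of_nonneg _ s.coe_nonneg,
    ← NNReal.finsetProd_rpow, ENNReal.ofNNReal_finsetProd]
  exact Finset.prod_le_prod' fun i _ => hμ (ω i)

theorem infinitePi_singleton_eq_zero {θ : ℝ≥0} (hθ : θ < 1) (hr : ∀ i, r i ≤ θ) (hs : s ≠ 0)
    (hμ : ∀ i, μ {i} ≤ (r i ^ (s : ℝ) : ℝ≥0)) (ω : ℕ → ι) :
    Measure.infinitePi (fun _ : ℕ => μ) {ω} = 0 := by
  have hs_pos : (0 : ℝ) < s := NNReal.coe_pos.2 (pos_iff_ne_zero.2 hs)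
  have hlim : Tendsto (fun n : ℕ => ((θ ^ n : ℝ≥0) : ℝ≥0∞) ^ (s : ℝ)) atTop (𝓝 0) := by
    have hθn := ENNReal.tendsto_coe.2 (NNReal.tendsto_pow_atTop_nhds_zero_of_lt_one hθ)
    simpa [hs_pos, comp_def] using
      (ENNReal.continuous_rpow_const (y := (s : ℝ))).continuousAt.tendsto.comp hθn
  refine le_antisymm (ge_of_tendsto' hlim fun n => ?_) bot_le
  refine (measure_mono (singleton_subset_iff.2 (PiNat.self_mem_cylinder ω n))).trans
    ((infinitePi_cylinder_le hμ ω n).trans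
      (ENNReal.rpow_le_rpow (ENNReal.coe_le_coe.2 ?_) hs_pos.le))
  simpa using Finset.prod_le_pow_card (Finset.range n) (fun i => r (ω i)) θ fun i _ => hr (ω i)

theorem mul_infinitePi_preimage_le [PseudoEMetricSpace X] {π : (ℕ → ι) → X} {θ δ : ℝ≥0}
    (hθ : θ < 1) (hr : ∀ i, r i ≤ θ)
    (hsep : ∀ ω ω' n, ω' ∈ PiNat.cylinder ω n → ω' n ≠ ω n →
      (δ * ∏ i ∈ Finset.range n, r (ω i) : ℝ≥0) ≤ edist (π ω) (π ω'))
    (hs : s ≠ 0) (hμ : ∀ i, μ {i} ≤ (r i ^ (s : ℝ) : ℝ≥0)) (S : Set X) :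
    (δ : ℝ≥0∞) ^ (s : ℝ) * Measure.infinitePi (fun _ : ℕ => μ) (π ⁻¹' S) ≤
      Metric.ediam S ^ (s : ℝ) := by
  rcases (π ⁻¹' S).subsingleton_or_nontrivial with hA | hA
  · rcases hA.eq_empty_or_singleton with hA | ⟨ω, hA⟩
    · simp [hA]
    · simp [hA, infinitePi_singleton_eq_zero hθ hr hs hμ ω]
  · obtain ⟨ω, hω, ω', hω', n, hne, hsub⟩ := exists_subset_cylinder_of_nontrivial hA
    calc _ ≤ (δ : ℝ≥0∞) ^ (s : ℝ) *
          ((∏ i ∈ Finset.range n, r (ω i) : ℝ≥0) : ℝ≥0∞) ^ (s : ℝ) := by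
          gcongr
          exact (measure_mono hsub).trans (infinitePi_cylinder_le hμ ω n)
      _ = ((δ * ∏ i ∈ Finset.range n, r (ω i) : ℝ≥0) : ℝ≥0∞) ^ (s : ℝ) := by
          rw [ENNReal.coe_mul, ENNReal.mul_rpow_of_nonneg _ _ s.coe_nonneg]
      _ ≤ _ := ENNReal.rpow_le_rpow
          ((hsep ω ω' n (hsub hω') hne).trans (Metric.edist_le_ediam_of_mem hω hω')) s.coe_nonneg

end ProductMeasure

variable {φ : ι → X → X}

theorem le_edist_coding [PseudoEMetricSpace X] {r : ι → ℝ≥0}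
    (hr : ∀ i x y, r i * edist x y ≤ edist (φ i x) (φ i y))
    {δ : ℝ≥0} (hδ : ∀ i j, i ≠ j → ∀ x y, (δ : ℝ≥0∞) ≤ edist (φ i x) (φ j y))
    {π : (ℕ → ι) → X} (hπ : ∀ ω, π ω = φ (ω 0) (π fun n => ω (n + 1))) {ω ω' : ℕ → ι} {n : ℕ}
    (hcyl : ω' ∈ PiNat.cylinder ω n) (hne : ω' n ≠ ω n) :
    (δ * ∏ i ∈ Finset.range n, r (ω i) : ℝ≥0) ≤ edist (π ω) (π ω') := by
  induction n generalizing ω ω' with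
  | zero =>
    rw [hπ ω, hπ ω']
    simpa using hδ _ _ hne.symm _ _
  | succ n ih =>
    have htail := @ih (fun n => ω (n + 1)) (fun n => ω' (n + 1))
      (fun i hi => hcyl (i + 1) (by lia)) hne
    rw [hπ ω, hπ ω', hcyl 0 n.succ_pos, Finset.prod_range_succ', ← mul_assoc, mul_comm,
      ENNReal.coe_mul]
    refine le_trans ?_ (hr _ _ _)
    gcongr

variable [MetricSpace X] [CompactSpace X]

theorem exists_continuousMap_coding [Nonempty X] [TopologicalSpace ι] [DiscreteTopology ι]
    [Finite ι] {θ : ℝ≥0} (hθ : θ < 1) (hφ : ∀ i, LipschitzWith θ (φ i)) :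
    ∃ π : C(ℕ → ι, X), ∀ ω, π ω = φ (ω 0) (π fun n => ω (n + 1)) := by
  have : Nonempty C(ℕ → ι, X) := ⟨.const _ (Classical.arbitrary X)⟩
  have hφc : Continuous (uncurry φ) := continuous_prod_of_discrete_left.2 fun i => (hφ i).continuous
  let T (π : C(ℕ → ι, X)) : C(ℕ → ι, X) :=
    ⟨fun ω => uncurry φ (ω 0, π fun n => ω (n + 1)), by fun_prop⟩
  have hT : ContractingWith θ T := by
    refine ⟨hθ, LipschitzWith.of_dist_le_mul fun f g => ?_⟩
    refine (ContinuousMap.dist_le (by positivity)).2 fun ω => ?_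
    refine ((hφ (ω 0)).dist_le_mul _ _).trans ?_
    gcongr
    exact ContinuousMap.dist_apply_le_dist _
  exact ⟨hT.fixedPoint, fun ω => DFunLike.congr_fun hT.fixedPoint_isFixedPt.symm ω⟩

theorem exists_pos_le_edist_of_injective [Finite ι] (hφc : ∀ i, Continuous (φ i))
    (hφ : Injective (uncurry φ)) :
    ∃ δ : ℝ≥0, δ ≠ 0 ∧ ∀ i j, i ≠ j → ∀ x y, (δ : ℝ≥0∞) ≤ edist (φ i x) (φ j y) := by
  have hpair (i j : ι) : ∀ᶠ δ : ℝ≥0 in 𝓝[≠] 0,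
      i ≠ j → ∀ x y, (δ : ℝ≥0∞) ≤ edist (φ i x) (φ j y) := by
    rcases eq_or_ne i j with rfl | hij
    · simp
    have hdisj : Disjoint (range (φ i)) (range (φ j)) := by
      rw [disjoint_left]
      rintro _ ⟨x, rfl⟩ ⟨y, hy⟩
      exact hij.symm (congrArg Prod.fst (@hφ (j, y) (i, x) hy))
    obtain ⟨r, hr, hlt⟩ := Metric.exists_pos_forall_lt_edist (isCompact_range (hφc i))
      (isCompact_range (hφc j)).isClosed hdisj
    filter_upwards [nhdsWithin_le_nhds (eventually_lt_nhds hr)] with δ hδ _ x y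
    exact (ENNReal.coe_le_coe.2 hδ.le).trans (hlt _ ⟨x, rfl⟩ _ ⟨y, rfl⟩).le
  have hall := eventually_all.2 fun i => eventually_all.2 (hpair i)
  obtain ⟨δ, hδ, hδ0⟩ := (hall.and self_mem_nhdsWithin).exists
  exact ⟨δ, hδ0, hδ⟩

end Coding

/-- Moran's lower bound: the image of a suitable product measure under the coding map satisfies the
hypothesis of the mass distribution principle. -/
theorem le_dimH_univ_of_one_le_sum {ι X : Type*} [Fintype ι] [MetricSpace X] [CompactSpace X]
    [Nonempty X] {φ : ι → X → X} (hinj : Injective (uncurry φ)) {θ : ℝ≥0} (hθ : θ < 1)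
    (hφ : ∀ i, LipschitzWith θ (φ i)) {r : ι → ℝ≥0} (hrθ : ∀ i, r i ≤ θ)
    (hr : ∀ i x y, r i * edist x y ≤ edist (φ i x) (φ i y)) {s : ℝ≥0}
    (hs : 1 ≤ ∑ i, r i ^ (s : ℝ)) : (s : ℝ≥0∞) ≤ dimH (univ : Set X) := by
  rcases eq_or_ne s 0 with rfl | hs0
  · simp
  let _ : TopologicalSpace ι := ⊥
  have : DiscreteTopology ι := ⟨rfl⟩
  borelize ι X
  obtain ⟨μ, hμ, hμr⟩ := exists_isProbabilityMeasure_singleton_le hs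
  obtain ⟨π, hπ⟩ := exists_continuousMap_coding hθ hφ
  obtain ⟨δ, hδ0, hδ⟩ := exists_pos_le_edist_of_injective (fun i => (hφ i).continuous) hinj
  have hπm : Measurable π := π.continuous.measurable
  refine le_dimH_of_mul_measure_le (ν := (Measure.infinitePi fun _ : ℕ => μ).map π)
    (c := (δ : ℝ≥0∞) ^ (s : ℝ)) ?_ ?_ fun S hS => ?_
  · simp [Measure.map_apply hπm MeasurableSet.univ]
  · simp [hδ0]
  · rw [Measure.map_apply hπm hS.measurableSet]
    exact mul_infinitePi_preimage_le hθ hrθ (fun _ _ _ => le_edist_coding hr hδ hπ) hs0 hμr S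

end Moran

section LowerBound

open scoped NNReal ENNReal
open Function Set

namespace IsConformalIFS

variable {ι X : Type*} [Fintype ι] {φ : ι → X → X} {ρ : ι → X → ℝ} {θ L : ℝ≥0} [MetricSpace X]

/-- Lowering the exponent from `s` to `t` multiplies each term by at least `θ ^ (t - s)`, and `θ` is
small for the system of long words. -/
theorem rpow_sub_mul_sum_weight_rpow_le (h : IsConformalIFS φ ρ θ L) {t s : ℝ} (hts : t ≤ s)
    (x : X) :
    (θ : ℝ) ^ (t - s) * ∑ i, ρ i x ^ s ≤ ∑ i, ρ i x ^ t := by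
  rw [Finset.mul_sum]
  refine Finset.sum_le_sum fun i _ => ?_
  have hρ := h.weight_pos i x
  calc (θ : ℝ) ^ (t - s) * ρ i x ^ s ≤ ρ i x ^ (t - s) * ρ i x ^ s := by
        refine mul_le_mul_of_nonneg_right ?_ (Real.rpow_nonneg hρ.le s)
        exact Real.rpow_le_rpow_of_nonpos hρ (h.weight_le i x) (sub_nonpos.2 hts)
    _ = ρ i x ^ t := by rw [← Real.rpow_add hρ, sub_add_cancel]

variable [CompactSpace X] [Nonempty X]

theorem le_dimH_univ_of_one_le_sum (h : IsConformalIFS φ ρ θ L) (hθ : θ < 1)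
    (hinj : Injective (uncurry φ)) {s : ℝ≥0} (x : X)
    (hs : Real.exp (3 * (L * Metric.diam (univ : Set X))) ^ (s : ℝ) ≤ ∑ i, ρ i x ^ (s : ℝ)) :
    (s : ℝ≥0∞) ≤ dimH (univ : Set X) := by
  set C := Real.exp (3 * (L * Metric.diam (univ : Set X)))
  have hC : 1 ≤ C := Real.one_le_exp (by positivity)
  have hC0 : 0 < C := one_pos.trans_le hC
  let r (i : ι) : ℝ≥0 := (C⁻¹ * ρ i x).toNNReal
  have hr (i : ι) : (r i : ℝ) = C⁻¹ * ρ i x :=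
    Real.coe_toNNReal _ (mul_nonneg (inv_nonneg.2 hC0.le) (h.weight_pos i x).le)
  refine _root_.le_dimH_univ_of_one_le_sum hinj hθ h.lipschitzWith (r := r) (fun i => ?_)
    (fun i y z => ?_) ?_
  · rw [← NNReal.coe_le_coe, hr]
    exact (mul_le_of_le_one_left (h.weight_pos i x).le (inv_le_one_of_one_le₀ hC)).trans
      (h.weight_le i x)
  · rw [edist_nndist, edist_nndist, ← ENNReal.coe_mul, ENNReal.coe_le_coe, ← NNReal.coe_le_coe]
    simpa [hr, C, Real.exp_neg] using h.le_dist_map_exp_diam i y z x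
  · rw [← NNReal.coe_le_coe]
    push_cast
    simp only [hr, Real.mul_rpow (inv_nonneg.2 hC0.le) (h.weight_pos _ x).le,
      Real.inv_rpow hC0.le, ← Finset.mul_sum]
    rwa [le_inv_mul_iff₀ (Real.rpow_pos_of_pos hC0 _), mul_one]

theorem le_dimH_univ (h : IsConformalIFS φ ρ θ L) (hθ : θ < 1) (hinj : Injective (uncurry φ))
    {s : ℝ≥0} {f : X → ℝ} (hf : Continuous f) (hf_pos : ∀ x, 0 < f x)
    (hfs : f ≤ transfer φ ρ s f) : (s : ℝ≥0∞) ≤ dimH (univ : Set X) := by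
  refine ENNReal.le_of_forall_nnreal_lt fun t hts => ?_
  obtain ⟨x⟩ := ‹Nonempty X›
  obtain ⟨x₁, -, hmax⟩ := isCompact_univ.exists_isMaxOn ⟨x, mem_univ _⟩ hf.continuousOn
  obtain ⟨M, hM⟩ := exists_wordRate hθ L
  obtain ⟨i⟩ : Nonempty ι := by
    by_contra hι
    rw [not_nonempty_iff] at hι
    exact (hf_pos x).not_ge (by simpa [transfer] using hfs x)
  have hθ0 : (0 : ℝ) < θ := (h.weight_pos i x).trans_le (h.weight_le i x)
  have hrate : 1 < (θ : ℝ) ^ ((t : ℝ) - s) :=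
    Real.one_lt_rpow_of_pos_of_lt_one_of_neg hθ0 (by exact_mod_cast hθ)
      (sub_neg.2 (by exact_mod_cast hts))
  have hlim : Tendsto (fun n : ℕ => ((θ : ℝ) ^ ((t : ℝ) - s)) ^ n * (f x / f x₁)) atTop atTop :=
    (tendsto_pow_atTop_atTop_of_one_lt hrate).atTop_mul_const (div_pos (hf_pos x) (hf_pos x₁))
  obtain ⟨n, hn, hn0⟩ := ((hlim.eventually_ge_atTop
    (Real.exp (3 * (M * Metric.diam (univ : Set X))) ^ (t : ℝ))).and (eventually_ne_atTop 0)).exists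
  have : Nonempty X := ⟨x⟩
  refine (h.word hM n).le_dimH_univ_of_one_le_sum (pow_lt_one₀ bot_le hθ hn0)
    (uncurry_wordMap_injective hinj n) x (hn.trans ?_)
  refine le_trans ?_ ((h.word hM n).rpow_sub_mul_sum_weight_rpow_le
    (NNReal.coe_le_coe.2 (ENNReal.coe_lt_coe.1 hts).le) x)
  rw [NNReal.coe_pow, Real.rpow_pow_comm hθ0.le]
  gcongr
  exact (h.word hM n).le_sum_weight_rpow (hf_pos x₁) (fun y => hmax (mem_univ y))
    (h.le_transfer_word hM hfs n) x

end IsConformalIFS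

end LowerBound

section ContinuedFractions

open scoped NNReal ENNReal
open Function Set

variable {m : ℕ}

/-- The inverse branch `x ↦ 1 / (k + 1 + x)` of the Gauss map, prepending the digit `k + 1`. -/
noncomputable def cfBranch (k : Fin m) (x : ℝ) : ℝ := (k + 1 + x)⁻¹

/-- The absolute value of the derivative of `cfBranch k`. -/
noncomputable def cfWeight (k : Fin m) (x : ℝ) : ℝ := cfBranch k x ^ 2

/-- An interval mapped into itself by all `cfBranch k`, on which they are uniform contractions. -/
def trapInterval (m : ℕ) : Set ℝ := Icc (1 / (m + 1)) ((m + 1) / (m + 2))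

theorem trapInterval_subset_Ioo : trapInterval m ⊆ Ioo 0 1 := fun x hx =>
  ⟨lt_of_lt_of_le (by positivity) hx.1,
    hx.2.trans_lt ((div_lt_one (by positivity)).2 (by linarith))⟩

theorem nonempty_trapInterval [NeZero m] : (trapInterval m).Nonempty := by
  have hm : (1 : ℝ) ≤ m := by exact_mod_cast NeZero.one_le
  refine nonempty_Icc.2 ((div_le_div_iff₀ (by positivity) (by positivity)).2 ?_)
  nlinarith

theorem cfBranch_pos (k : Fin m) {x : ℝ} (hx : 0 ≤ x) : 0 < cfBranch k x := by
  unfold cfBranch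
  positivity

theorem cfBranch_le_one (k : Fin m) {x : ℝ} (hx : 0 ≤ x) : cfBranch k x ≤ 1 :=
  inv_le_one_of_one_le₀ (by linarith [Nat.cast_nonneg (α := ℝ) k.1])

theorem mapsTo_cfBranch_trapInterval (k : Fin m) :
    MapsTo (cfBranch k) (trapInterval m) (trapInterval m) := by
  intro x hx
  have hk : (k : ℝ) + 1 ≤ m := by exact_mod_cast k.2
  have hx01 := trapInterval_subset_Ioo hx
  have hkx : 0 < (k : ℝ) + 1 + x := by linarith [hx01.1, Nat.cast_nonneg (α := ℝ) k.1]
  refine ⟨?_, ?_⟩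
  · rw [one_div]
    exact inv_anti₀ hkx (by linarith [hx01.2])
  · rw [← inv_div]
    refine inv_anti₀ (by positivity) ?_
    calc ((m : ℝ) + 2) / (m + 1) = 1 + 1 / (m + 1) := by field_simp; ring
      _ ≤ k + 1 + x := by linarith [hx.1, Nat.cast_nonneg (α := ℝ) k.1]

theorem abs_cfBranch_sub (k : Fin m) {x y : ℝ} (hx : 0 ≤ x) (hy : 0 ≤ y) :
    |cfBranch k x - cfBranch k y| = cfBranch k x * cfBranch k y * |x - y| := by
  have hx' := cfBranch_pos k hx
  have hy' := cfBranch_pos k hy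
  have hsub : cfBranch k x - cfBranch k y = cfBranch k x * (y - x) * cfBranch k y := by
    rw [cfBranch, cfBranch, inv_sub_inv' (inv_pos.1 hx').ne' (inv_pos.1 hy').ne',
      add_sub_add_left_eq_sub]
  rw [hsub, abs_mul, abs_mul, abs_of_pos hx', abs_of_pos hy', abs_sub_comm, mul_right_comm]

theorem cfBranch_le_exp_mul (k : Fin m) {x y : ℝ} (hx : 0 ≤ x) (hy : 0 ≤ y) :
    cfBranch k y ≤ Real.exp |x - y| * cfBranch k x := by
  have := cfBranch_pos k hy
  calc cfBranch k y = cfBranch k x + (cfBranch k y - cfBranch k x) := by ring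
    _ ≤ cfBranch k x + cfBranch k y * cfBranch k x * |y - x| := by
      rw [← abs_cfBranch_sub k hy hx]
      gcongr
      exact le_abs_self _
    _ ≤ cfBranch k x + 1 * cfBranch k x * |y - x| := by
      have := cfBranch_pos k hx
      gcongr
      exact cfBranch_le_one k hy
    _ = (|x - y| + 1) * cfBranch k x := by rw [abs_sub_comm]; ring
    _ ≤ _ := mul_le_mul_of_nonneg_right (Real.add_one_le_exp _) (cfBranch_pos k hx).le

theorem cfBranch_injective {k l : Fin m} {x y : ℝ} (hx : x ∈ Ico 0 1) (hy : y ∈ Ico 0 1)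
    (h : cfBranch k x = cfBranch l y) : k = l ∧ x = y := by
  have heq : (k : ℝ) + 1 + x = l + 1 + y := inv_injective h
  have hkl : (k : ℤ) = l := by
    have hfloor := congrArg Int.floor (show (k : ℝ) + x = l + y by linarith)
    simpa [Int.floor_natCast_add, Int.floor_eq_zero_iff.2 hx, Int.floor_eq_zero_iff.2 hy]
      using hfloor
  obtain rfl : k = l := Fin.ext (by exact_mod_cast hkl)
  exact ⟨rfl, by linarith⟩

/-- The contraction ratio of the branches on `trapInterval m`. -/
noncomputable def trapRatio (m : ℕ) : ℝ≥0 := (m + 1) / (m + 2)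

theorem trapRatio_lt_one (m : ℕ) : trapRatio m < 1 := by
  rw [trapRatio, div_lt_one (by positivity)]
  gcongr
  exact one_lt_two

theorem le_trapRatio {x : ℝ} (hx : x ∈ trapInterval m) : x ≤ trapRatio m := by
  simpa [trapRatio] using hx.2

theorem isConformalIFS_cfBranch {A : Set ℝ} (hA : A ⊆ trapInterval m)
    (hmaps : ∀ k : Fin m, MapsTo (cfBranch k) A A) :
    IsConformalIFS (fun k => (hmaps k).restrict) (fun k x => cfWeight k x) (trapRatio m) 1 := by
  have hA0 (x : A) : (0 : ℝ) ≤ x := (trapInterval_subset_Ioo (hA x.2)).1.le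
  have hdist (k : Fin m) (x y : A) :
      dist ((hmaps k).restrict _ _ _ x) ((hmaps k).restrict _ _ _ y) =
        cfBranch k x * cfBranch k y * dist x y :=
    abs_cfBranch_sub k (hA0 x) (hA0 y)
  have hpos (k : Fin m) (x : A) : 0 < cfBranch k x := cfBranch_pos k (hA0 x)
  have hle_one (k : Fin m) (x : A) : cfBranch k x ≤ 1 := cfBranch_le_one k (hA0 x)
  have hle_ratio (k : Fin m) (x : A) : cfBranch k x ≤ trapRatio m :=
    le_trapRatio (mapsTo_cfBranch_trapInterval k (hA x.2))
  refine ⟨fun k => LipschitzWith.of_dist_le_mul fun x y => ?_, fun k x => pow_pos (hpos k x) 2,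
    fun k x => ?_, fun k x y => ?_, fun k x y => ?_⟩
  · rw [hdist]
    gcongr
    exact (mul_le_of_le_one_left (hpos k y).le (hle_one k x)).trans (hle_ratio k y)
  · rw [cfWeight, sq]
    exact (mul_le_of_le_one_left (hpos k x).le (hle_one k x)).trans (hle_ratio k x)
  · rw [hdist, cfWeight, sq, NNReal.coe_one, one_mul, mul_left_comm]
    have := hpos k x
    gcongr
    exact cfBranch_le_exp_mul k (hA0 x) (hA0 y)
  · rw [hdist, cfWeight, sq, NNReal.coe_one, one_mul, ← mul_assoc, mul_left_comm, dist_comm x y]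
    have := hpos k x
    gcongr
    exact cfBranch_le_exp_mul k (hA0 y) (hA0 x)

theorem digitContFract_convs_zero (a : ℕ → ℕ) : (digitContFract a).convs 0 = 0 := by
  simp [digitContFract]

theorem digitContFract_convs_succ {a : ℕ → ℕ} (ha : ∀ n, 0 < a n) (n : ℕ) :
    (digitContFract a).convs (n + 1) =
      (a 0 + (digitContFract fun i => a (i + 1)).convs n)⁻¹ := by
  have hconvs {b : ℕ → ℕ} (hb : ∀ n, 0 < b n) (n : ℕ) :
      (digitContFract b).convs n = GenContFract.convs'Aux (digitContFract b).s n := by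
    rw [GenContFract.convs_eq_convs', GenContFract.convs', digitContFract, zero_add]
    rintro _ k - hk
    obtain rfl := Option.some.inj hk
    exact ⟨one_pos, Nat.cast_pos.2 (hb k)⟩
  rw [hconvs ha, hconvs fun i => ha (i + 1), ← one_div]
  rfl

theorem digitContFract_convs_nonneg {a : ℕ → ℕ} (ha : ∀ n, 0 < a n) (n : ℕ) :
    0 ≤ (digitContFract a).convs n := by
  induction n generalizing a with
  | zero => rw [digitContFract_convs_zero]
  | succ n ih =>
    rw [digitContFract_convs_succ ha]
    exact inv_nonneg.2 (add_nonneg (a 0).cast_nonneg (ih fun i => ha (i + 1)))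

theorem abs_convs_sub_coding_le {π : (ℕ → Fin m) → trapInterval m}
    (hπ : ∀ ω, (π ω : ℝ) = cfBranch (ω 0) (π fun n => ω (n + 1))) (ω : ℕ → Fin m) (n : ℕ) :
    |(digitContFract fun i => ω i + 1).convs n - π ω| ≤ trapRatio m ^ n := by
  have hπ01 (ω : ℕ → Fin m) := trapInterval_subset_Ioo (π ω).2
  induction n generalizing ω with
  | zero =>
    rw [digitContFract_convs_zero, zero_sub, abs_neg, abs_of_pos (hπ01 ω).1, pow_zero]
    exact (hπ01 ω).2.le
  | succ n ih =>
    have hconvs := digitContFract_convs_nonneg (a := fun i => ω (i + 1) + 1)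
      (fun _ => Nat.succ_pos _) n
    have hbranch : (digitContFract fun i => ω i + 1).convs (n + 1) =
        cfBranch (ω 0) ((digitContFract fun i => ω (i + 1) + 1).convs n) := by
      rw [digitContFract_convs_succ fun _ => Nat.succ_pos _, cfBranch, Nat.cast_succ]
    have hratio := hπ ω ▸ le_trapRatio (π ω).2
    rw [hbranch, hπ, abs_cfBranch_sub _ hconvs (hπ01 _).1.le, pow_succ']
    refine mul_le_mul ?_ (ih _) (abs_nonneg _) (trapRatio m).2
    exact mul_le_of_le_one_left (cfBranch_pos _ (hπ01 _).1.le).le (cfBranch_le_one _ hconvs)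
      |>.trans hratio

theorem tendsto_convs_coding {π : (ℕ → Fin m) → trapInterval m}
    (hπ : ∀ ω, (π ω : ℝ) = cfBranch (ω 0) (π fun n => ω (n + 1))) (ω : ℕ → Fin m) :
    Tendsto (fun n => (digitContFract fun i => ω i + 1).convs n) atTop (𝓝 (π ω)) := by
  rw [tendsto_iff_dist_tendsto_zero]
  exact squeeze_zero (fun _ => dist_nonneg) (abs_convs_sub_coding_le hπ ω)
    (tendsto_pow_atTop_nhds_zero_of_lt_one (trapRatio m).2 (trapRatio_lt_one m))

theorem cantorE_eq_range {π : (ℕ → Fin m) → trapInterval m}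
    (hπ : ∀ ω, (π ω : ℝ) = cfBranch (ω 0) (π fun n => ω (n + 1))) :
    cantorE m = range fun ω => (π ω : ℝ) := by
  ext x
  constructor
  · rintro ⟨a, ha, hx⟩
    have hω : a = fun i => a i - 1 + 1 := funext fun i => (Nat.sub_add_cancel (ha i).1).symm
    rw [hω] at hx
    exact ⟨_, tendsto_nhds_unique
      (tendsto_convs_coding hπ fun i => ⟨a i - 1, by have := ha i; lia⟩) hx⟩
  · rintro ⟨ω, rfl⟩
    exact ⟨_, fun n => ⟨Nat.le_add_left _ _, (ω n).2⟩, tendsto_convs_coding hπ ω⟩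

variable [NeZero m]

variable (m) in
theorem exists_cfCoding : ∃ π : C(ℕ → Fin m, trapInterval m),
    ∀ ω, (π ω : ℝ) = cfBranch (ω 0) (π fun n => ω (n + 1)) := by
  have : Nonempty (trapInterval m) := nonempty_trapInterval.to_subtype
  have : CompactSpace (trapInterval m) := isCompact_iff_compactSpace.1 isCompact_Icc
  obtain ⟨π, hπ⟩ := exists_continuousMap_coding (trapRatio_lt_one m)
    (isConformalIFS_cfBranch Subset.rfl mapsTo_cfBranch_trapInterval).lipschitzWith
  exact ⟨π, fun ω => congrArg Subtype.val (hπ ω)⟩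

theorem isCompact_cantorE : IsCompact (cantorE m) := by
  obtain ⟨π, hπ⟩ := exists_cfCoding m
  rw [cantorE_eq_range hπ]
  exact isCompact_range (continuous_subtype_val.comp π.continuous)

theorem nonempty_cantorE : (cantorE m).Nonempty := by
  obtain ⟨π, hπ⟩ := exists_cfCoding m
  rw [cantorE_eq_range hπ]
  exact range_nonempty _

theorem cantorE_subset_trapInterval : cantorE m ⊆ trapInterval m := by
  obtain ⟨π, hπ⟩ := exists_cfCoding m
  rw [cantorE_eq_range hπ]
  exact range_subset_iff.2 fun ω => (π ω).2

theorem mapsTo_cfBranch_cantorE (k : Fin m) : MapsTo (cfBranch k) (cantorE m) (cantorE m) := by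
  obtain ⟨π, hπ⟩ := exists_cfCoding m
  rw [cantorE_eq_range hπ]
  rintro _ ⟨ω, rfl⟩
  exact ⟨fun n => n.casesOn k ω, hπ _⟩

theorem exists_cfBranch_eq_of_mem_cantorE {x : ℝ} (hx : x ∈ cantorE m) :
    ∃ k : Fin m, ∃ y ∈ cantorE m, cfBranch k y = x := by
  obtain ⟨π, hπ⟩ := exists_cfCoding m
  rw [cantorE_eq_range hπ] at hx ⊢
  obtain ⟨ω, rfl⟩ := hx
  exact ⟨ω 0, _, ⟨_, rfl⟩, (hπ ω).symm⟩

theorem dimH_cantorE_le {s : ℝ≥0} {f : ℝ → ℝ} (hf : ContinuousOn f (cantorE m))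
    (hf_pos : ∀ x ∈ cantorE m, 0 < f x)
    (hfs : ∀ x ∈ cantorE m, transfer (cfBranch (m := m)) cfWeight s f x ≤ f x) :
    dimH (cantorE m) ≤ s := by
  have := isCompact_iff_compactSpace.1 (isCompact_cantorE (m := m))
  rw [← Subtype.coe_image_univ (cantorE m), isometry_subtype_coe.dimH_image]
  refine (isConformalIFS_cfBranch cantorE_subset_trapInterval mapsTo_cfBranch_cantorE).dimH_univ_le
    (trapRatio_lt_one m) (fun x => ?_) hf.domRestrict (fun x => hf_pos x x.2) fun x => hfs x x.2
  obtain ⟨k, y, hy, hyx⟩ := exists_cfBranch_eq_of_mem_cantorE x.2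
  exact ⟨(k, ⟨y, hy⟩), Subtype.ext hyx⟩

theorem le_dimH_cantorE {s : ℝ≥0} {f : ℝ → ℝ} (hf : ContinuousOn f (cantorE m))
    (hf_pos : ∀ x ∈ cantorE m, 0 < f x)
    (hfs : ∀ x ∈ cantorE m, f x ≤ transfer (cfBranch (m := m)) cfWeight s f x) :
    s ≤ dimH (cantorE m) := by
  have := isCompact_iff_compactSpace.1 (isCompact_cantorE (m := m))
  have := (nonempty_cantorE (m := m)).to_subtype
  have h01 (x : cantorE m) := trapInterval_subset_Ioo (cantorE_subset_trapInterval x.2)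
  rw [← Subtype.coe_image_univ (cantorE m), isometry_subtype_coe.dimH_image]
  refine (isConformalIFS_cfBranch cantorE_subset_trapInterval mapsTo_cfBranch_cantorE).le_dimH_univ
    (trapRatio_lt_one m) ?_ hf.domRestrict (fun x => hf_pos x x.2) fun x => hfs x x.2
  rintro ⟨k, x⟩ ⟨l, y⟩ h
  obtain ⟨rfl, hxy⟩ := cfBranch_injective (Ioo_subset_Ico_self (h01 x))
    (Ioo_subset_Ico_self (h01 y)) (congrArg Subtype.val h)
  rw [Subtype.ext hxy]

end ContinuedFractions

section Expansion

variable {𝕜 ι : Type*} [Field 𝕜] [Fintype ι]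

/-- The binomial coefficients `q * (q + 1) * ⋯ * (q + n - 1) / n!` of the power series of
`(1 - z) ^ (-q)`. The recursion makes them computable over `ℚ`. -/
def risingCoeff (q : 𝕜) : ℕ → 𝕜
  | 0 => 1
  | n + 1 => risingCoeff q n * ((q + n) / (n + 1))

/-- The polynomial function of degree less than `M` with coefficients `c`. -/
def polyFun (c : ℕ → 𝕜) (M : ℕ) (x : 𝕜) : 𝕜 := ∑ j ∈ Finset.range M, c j * x ^ j

/-- The coefficient of `u ^ n` in `polyFun c M (x + u)`. Where `j - n` is truncated, the binomial
coefficient vanishes. -/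
def taylorCoeff (c : ℕ → 𝕜) (M : ℕ) (x : 𝕜) (n : ℕ) : 𝕜 :=
  ∑ j ∈ Finset.range M, c j * (j.choose n * x ^ (j - n))

/-- The weighted sum of the negative powers of the centers `a`. -/
def moment (W a : ι → 𝕜) (i : ℕ) : 𝕜 := ∑ k, W k / a k ^ i

/-- The coefficient of `u ^ n` in `∑ k, W k * ((1 + u / a k) ^ (-q) * polyFun c M (a k + u)⁻¹)`. -/
def branchCoeff (c : ℕ → 𝕜) (M : ℕ) (q : 𝕜) (W a : ι → 𝕜) (n : ℕ) : 𝕜 :=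
  ∑ j ∈ Finset.range M, c j * ((-1) ^ n * (risingCoeff (q + j) n * moment W a (j + n)))

theorem risingCoeff_mul_factorial (q : ℝ) (n : ℕ) :
    risingCoeff q n * n.factorial = (ascPochhammer ℝ n).eval q := by
  induction n with
  | zero => simp [risingCoeff]
  | succ n ih =>
    rw [ascPochhammer_succ_eval, ← ih, risingCoeff, Nat.factorial_succ]
    push_cast
    field_simp

theorem risingCoeff_nonneg {q : ℝ} (hq : 0 ≤ q) (n : ℕ) : 0 ≤ risingCoeff q n := by
  induction n with
  | zero => exact zero_le_one
  | succ n ih => exact mul_nonneg ih (by positivity)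

theorem hasSum_risingCoeff (q : ℝ) {z : ℝ} (hz : |z| < 1) :
    HasSum (fun n => risingCoeff q n * (-z) ^ n) ((1 + z) ^ (-q)) := by
  have h := (Real.one_div_one_sub_rpow_hasFPowerSeriesOnBall_zero q).hasSum (y := -z)
    (by simpa [enorm_eq_nnnorm, ← NNReal.coe_lt_coe] using hz)
  simp only [zero_add, sub_neg_eq_add, one_div] at h
  rw [← Real.rpow_neg (by linarith [abs_lt.1 hz])] at h
  refine h.congr_fun fun n => ?_
  rw [FormalMultilinearSeries.ofScalars_apply_eq, smul_eq_mul, Ring.choose,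
    show q + n - 1 - n + 1 = q by ring]
  congr 1
  refine mul_right_cancel₀ (Nat.cast_ne_zero.2 n.factorial_ne_zero) ?_
  rw [risingCoeff_mul_factorial, ← Polynomial.ascPochhammer_smeval_eq_eval,
    ← Ring.factorial_nsmul_multichoose_eq_ascPochhammer, nsmul_eq_mul, mul_comm]

theorem risingCoeff_add_mul_pow_le {q z : ℝ} {N : ℕ} (hq : 1 ≤ q) (hz : 0 ≤ z)
    (hN : 2 * (q + N) * z ≤ N + 1) (i : ℕ) :
    risingCoeff q (i + N) * z ^ (i + N) ≤ risingCoeff q N * z ^ N * (1 / 2) ^ i := by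
  have hz_half : z ≤ 1 / 2 := by nlinarith
  induction i with
  | zero => simp
  | succ i ih =>
    have hratio : (q + (i + N : ℕ)) / ((i + N : ℕ) + 1) * z ≤ 1 / 2 := by
      rw [div_mul_eq_mul_div, div_le_iff₀ (by positivity)]
      push_cast
      nlinarith
    rw [Nat.add_right_comm]
    calc _ = risingCoeff q (i + N) * z ^ (i + N) *
          ((q + (i + N : ℕ)) / ((i + N : ℕ) + 1) * z) := by rw [risingCoeff]; ring
      _ ≤ risingCoeff q N * z ^ N * (1 / 2) ^ i * (1 / 2) := by
          have := risingCoeff_nonneg (zero_le_one.trans hq) N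
          gcongr
      _ = _ := by ring

theorem abs_one_add_rpow_sub_sum_le {q z : ℝ} {N : ℕ} (hq : 1 ≤ q)
    (hN : 2 * (q + N) * |z| ≤ N + 1) :
    |(1 + z) ^ (-q) - ∑ n ∈ Finset.range N, risingCoeff q n * (-z) ^ n| ≤
      2 * (risingCoeff q N * |z| ^ N) := by
  have hz : |z| < 1 := by nlinarith [abs_nonneg z]
  have hs := hasSum_risingCoeff q hz
  have hbound (i : ℕ) : ‖risingCoeff q (i + N) * (-z) ^ (i + N)‖ ≤
      risingCoeff q N * |z| ^ N * (1 / 2) ^ i := by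
    rw [norm_mul, norm_pow, norm_neg, Real.norm_eq_abs, Real.norm_eq_abs,
      abs_of_nonneg (risingCoeff_nonneg (zero_le_one.trans hq) _)]
    exact risingCoeff_add_mul_pow_le hq (abs_nonneg z) hN i
  rw [← hs.tsum_eq, ← hs.summable.sum_add_tsum_nat_add N, add_sub_cancel_left, ← Real.norm_eq_abs,
    mul_comm]
  exact tsum_of_norm_bounded (hasSum_geometric_two.mul_left _) hbound

theorem sum_taylorCoeff_mul_pow (c : ℕ → 𝕜) {M N : ℕ} (hMN : M ≤ N) (x u : 𝕜) :
    ∑ n ∈ Finset.range N, taylorCoeff c M x n * u ^ n = polyFun c M (x + u) := by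
  simp only [taylorCoeff, polyFun, Finset.sum_mul]
  rw [Finset.sum_comm]
  refine Finset.sum_congr rfl fun j hj => ?_
  have hsub : Finset.range (j + 1) ⊆ Finset.range N :=
    Finset.range_subset_range.2 ((Finset.mem_range.1 hj).trans_le hMN)
  rw [add_comm x, add_pow, Finset.mul_sum, ← Finset.sum_subset hsub]
  · exact Finset.sum_congr rfl fun n _ => by ring
  · intro n _ hn
    rw [Nat.choose_eq_zero_of_lt (by simpa using hn)]
    simp

theorem abs_sum_rpow_sub_sum_le {q : ℝ} {N : ℕ} (hq : 1 ≤ q) {W a : ι → ℝ} (hW : ∀ k, 0 ≤ W k)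
    (ha : ∀ k, 0 < a k) {u : ℝ} (hN : ∀ k, 2 * (q + N) * |u| ≤ (N + 1) * a k) :
    |∑ k, W k * (1 + u / a k) ^ (-q) -
      ∑ n ∈ Finset.range N, (-1) ^ n * (risingCoeff q n * moment W a n) * u ^ n| ≤
      2 * (risingCoeff q N * moment W a N) * |u| ^ N := by
  have hswap : ∑ n ∈ Finset.range N, (-1) ^ n * (risingCoeff q n * moment W a n) * u ^ n =
      ∑ k, W k * ∑ n ∈ Finset.range N, risingCoeff q n * (-(u / a k)) ^ n := by
    simp only [moment, Finset.mul_sum, Finset.sum_mul]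
    rw [Finset.sum_comm]
    refine Finset.sum_congr rfl fun k _ => Finset.sum_congr rfl fun n _ => ?_
    rw [neg_pow (u / a k), div_pow]
    ring
  rw [hswap, ← Finset.sum_sub_distrib]
  calc _ ≤ ∑ k, W k * (2 * (risingCoeff q N * |u / a k| ^ N)) := by
        refine (Finset.abs_sum_le_sum_abs _ _).trans (Finset.sum_le_sum fun k _ => ?_)
        rw [← mul_sub, abs_mul, abs_of_nonneg (hW k)]
        refine mul_le_mul_of_nonneg_left (abs_one_add_rpow_sub_sum_le hq ?_) (hW k)
        rw [abs_div, abs_of_pos (ha k), ← mul_div_assoc, div_le_iff₀ (ha k)]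
        exact hN k
    _ = _ := by
        simp only [moment, Finset.mul_sum, Finset.sum_mul]
        refine Finset.sum_congr rfl fun k _ => ?_
        rw [abs_div, abs_of_pos (ha k), div_pow]
        ring

/-- The factor in the truncation error of `∑ n < N, branchCoeff c M q W a n * u ^ n`. -/
def branchTail [LinearOrder 𝕜] (c : ℕ → 𝕜) (M : ℕ) (q : 𝕜) (W a : ι → 𝕜) (N : ℕ) : 𝕜 :=
  2 * ∑ j ∈ Finset.range M, |c j| * (risingCoeff (q + j) N * moment W a (j + N))

theorem moment_div_pow (W a : ι → 𝕜) (j n : ℕ) :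
    moment (fun k => W k / a k ^ j) a n = moment W a (j + n) := by
  simp only [moment, div_div, pow_add]

theorem abs_sum_rpow_mul_polyFun_sub_le (c : ℕ → ℝ) {M N : ℕ} {q : ℝ} (hq : 1 ≤ q) {W a : ι → ℝ}
    (hW : ∀ k, 0 ≤ W k) (ha : ∀ k, 0 < a k) {u : ℝ}
    (hN : ∀ k, 2 * (q + M + N) * |u| ≤ (N + 1) * a k) :
    |∑ k, W k * ((1 + u / a k) ^ (-q) * polyFun c M (a k + u)⁻¹) -
        ∑ n ∈ Finset.range N, branchCoeff c M q W a n * u ^ n| ≤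
      branchTail c M q W a N * |u| ^ N := by
  have hone_add (k : ι) : 0 < 1 + u / a k := by
    have : |u| < a k := by nlinarith [hN k, abs_nonneg u, ha k]
    rw [one_add_div (ha k).ne']
    exact div_pos (by linarith [neg_abs_le u]) (ha k)
  have hpow (j : ℕ) (k : ι) : W k / a k ^ j * (1 + u / a k) ^ (-(q + j)) =
      W k * ((1 + u / a k) ^ (-q) * (a k + u)⁻¹ ^ j) := by
    rw [show a k + u = a k * (1 + u / a k) by have := (ha k).ne'; field_simp, neg_add,
      Real.rpow_add (hone_add k), Real.rpow_neg (hone_add k).le j, Real.rpow_natCast, mul_inv,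
      mul_pow, inv_pow, inv_pow]
    ring
  have hsplit : ∑ k, W k * ((1 + u / a k) ^ (-q) * polyFun c M (a k + u)⁻¹) -
      ∑ n ∈ Finset.range N, branchCoeff c M q W a n * u ^ n =
      ∑ j ∈ Finset.range M, c j * (∑ k, W k / a k ^ j * (1 + u / a k) ^ (-(q + j)) -
        ∑ n ∈ Finset.range N, (-1) ^ n * (risingCoeff (q + j) n * moment W a (j + n)) * u ^ n) := by
    simp only [hpow, polyFun, branchCoeff, mul_sub, Finset.sum_sub_distrib, Finset.mul_sum,
      Finset.sum_mul]
    rw [Finset.sum_comm, Finset.sum_comm (s := Finset.range N)]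
    congr 1
    · exact Finset.sum_congr rfl fun j _ => Finset.sum_congr rfl fun k _ => by ring
    · exact Finset.sum_congr rfl fun j _ => Finset.sum_congr rfl fun n _ => by ring
  rw [hsplit, branchTail, Finset.mul_sum, Finset.sum_mul]
  refine (Finset.abs_sum_le_sum_abs _ _).trans (Finset.sum_le_sum fun j hj => ?_)
  have hjM : (j : ℝ) ≤ M := by exact_mod_cast (Finset.mem_range.1 hj).le
  have hterm := abs_sum_rpow_sub_sum_le (W := fun k => W k / a k ^ j) (N := N) (q := q + j)
    (by linarith [j.cast_nonneg (α := ℝ)]) (fun k => div_nonneg (hW k) (pow_nonneg (ha k).le j)) ha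
    (fun k => (by gcongr : _ ≤ 2 * (q + M + N) * |u|).trans (hN k))
  simp only [moment_div_pow] at hterm
  rw [abs_mul]
  refine (mul_le_mul_of_nonneg_left hterm (abs_nonneg _)).trans_eq ?_
  ring

theorem abs_sub_coeff_zero_le {t : ℕ → ℝ} {g u r E : ℝ} {N : ℕ} (hE : 0 ≤ E) (hu : |u| ≤ r)
    (hg : |g - ∑ n ∈ Finset.range (N + 1), t n * u ^ n| ≤ E * |u| ^ (N + 1)) :
    |g - t 0| ≤ ∑ n ∈ Finset.range N, |t (n + 1)| * r ^ (n + 1) + E * r ^ (N + 1) := by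
  rw [Finset.sum_range_succ', pow_zero, mul_one] at hg
  have hsum : |∑ n ∈ Finset.range N, t (n + 1) * u ^ (n + 1)| ≤
      ∑ n ∈ Finset.range N, |t (n + 1)| * r ^ (n + 1) := by
    refine (Finset.abs_sum_le_sum_abs _ _).trans (Finset.sum_le_sum fun n _ => ?_)
    rw [abs_mul, abs_pow]
    gcongr
  calc |g - t 0| = |∑ n ∈ Finset.range N, t (n + 1) * u ^ (n + 1) +
        (g - (∑ n ∈ Finset.range N, t (n + 1) * u ^ (n + 1) + t 0))| := by congr 1; ring
    _ ≤ _ := (abs_add_le _ _).trans (add_le_add hsum (hg.trans (by gcongr)))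

/-- The coefficient of `u ^ n` in the difference of `polyFun c M (x + u)` and
`∑ k, W k * ((1 + u / a k) ^ (-q) * polyFun c M (a k + u)⁻¹)`. -/
def gapCoeff (c : ℕ → 𝕜) (M : ℕ) (x q : 𝕜) (W a : ι → 𝕜) (n : ℕ) : 𝕜 :=
  taylorCoeff c M x n - branchCoeff c M q W a n

/-- A bound for the terms of positive degree in the expansion by `gapCoeff` when `|u| ≤ r`. -/
def gapOscillation [LinearOrder 𝕜] (c : ℕ → 𝕜) (M : ℕ) (x q : 𝕜) (W a : ι → 𝕜) (r : 𝕜) (N : ℕ) :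
    𝕜 :=
  ∑ n ∈ Finset.range N, |gapCoeff c M x q W a (n + 1)| * r ^ (n + 1) +
    branchTail c M q W a (N + 1) * r ^ (N + 1)

theorem branchTail_nonneg (c : ℕ → ℝ) (M : ℕ) {q : ℝ} (hq : 0 ≤ q) {W a : ι → ℝ}
    (hW : ∀ k, 0 ≤ W k) (ha : ∀ k, 0 < a k) (N : ℕ) : 0 ≤ branchTail c M q W a N := by
  have hmoment (i : ℕ) : 0 ≤ moment W a i :=
    Finset.sum_nonneg fun k _ => div_nonneg (hW k) (pow_nonneg (ha k).le i)
  exact mul_nonneg zero_le_two <| Finset.sum_nonneg fun j _ => mul_nonneg (abs_nonneg _) <|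
    mul_nonneg (risingCoeff_nonneg (by positivity) N) (hmoment _)

theorem abs_sub_gapCoeff_zero_le (c : ℕ → ℝ) {M N : ℕ} (hMN : M ≤ N + 1) (x : ℝ) {q : ℝ}
    (hq : 1 ≤ q) {W a : ι → ℝ} (hW : ∀ k, 0 ≤ W k) (ha : ∀ k, 0 < a k) {r u : ℝ}
    (hN : ∀ k, 2 * (q + M + (N + 1)) * r ≤ (N + 2) * a k) (hu : |u| ≤ r) :
    |(polyFun c M (x + u) - ∑ k, W k * ((1 + u / a k) ^ (-q) * polyFun c M (a k + u)⁻¹)) -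
      gapCoeff c M x q W a 0| ≤ gapOscillation c M x q W a r N := by
  refine abs_sub_coeff_zero_le (branchTail_nonneg c M (zero_le_one.trans hq) hW ha _) hu ?_
  have hbranch := abs_sum_rpow_mul_polyFun_sub_le c (M := M) (N := N + 1) hq hW ha (u := u)
    fun k => by
      refine le_trans ?_ ((hN k).trans_eq ?_)
      · push_cast
        gcongr
      · push_cast
        ring
  rw [abs_sub_comm] at hbranch
  convert hbranch using 2
  simp only [gapCoeff, sub_mul, Finset.sum_sub_distrib, sum_taylorCoeff_mul_pow c hMN]
  ring

end Expansion

section RationalExpansion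

variable {ι : Type*} [Fintype ι]

theorem cast_risingCoeff (q : ℚ) (n : ℕ) : ((risingCoeff q n : ℚ) : ℝ) = risingCoeff (q : ℝ) n := by
  induction n with
  | zero => simp [risingCoeff]
  | succ n ih => simp [risingCoeff, ih]

theorem cast_taylorCoeff (c : ℕ → ℚ) (M : ℕ) (x : ℚ) (n : ℕ) :
    ((taylorCoeff c M x n : ℚ) : ℝ) = taylorCoeff (fun j => (c j : ℝ)) M x n := by
  simp [taylorCoeff]

theorem cast_moment (W a : ι → ℚ) (i : ℕ) :
    ((moment W a i : ℚ) : ℝ) = moment (fun k => (W k : ℝ)) (fun k => (a k : ℝ)) i := by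
  simp [moment]

theorem cast_gapCoeff (c : ℕ → ℚ) (M : ℕ) (x q : ℚ) (W a : ι → ℚ) (n : ℕ) :
    ((gapCoeff c M x q W a n : ℚ) : ℝ) =
      gapCoeff (fun j => (c j : ℝ)) M x q (fun k => (W k : ℝ)) (fun k => (a k : ℝ)) n := by
  simp [gapCoeff, branchCoeff, cast_taylorCoeff, cast_risingCoeff, cast_moment]

theorem cast_gapOscillation (c : ℕ → ℚ) (M : ℕ) (x q : ℚ) (W a : ι → ℚ) (r : ℚ) (N : ℕ) :
    ((gapOscillation c M x q W a r N : ℚ) : ℝ) =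
      gapOscillation (fun j => (c j : ℝ)) M x q (fun k => (W k : ℝ)) (fun k => (a k : ℝ)) r N := by
  simp [gapOscillation, branchTail, cast_gapCoeff, cast_risingCoeff, cast_moment]

theorem polyFun_pos_of_sum_lt {c : ℕ → ℚ} {M : ℕ} {x r : ℚ}
    (h : ∑ n ∈ Finset.range M, |taylorCoeff c M x (n + 1)| * r ^ (n + 1) < taylorCoeff c M x 0)
    {y : ℝ} (hy : |y - x| ≤ r) : 0 < polyFun (fun j => (c j : ℝ)) M y := by
  have hosc : |polyFun (fun j => (c j : ℝ)) M y - taylorCoeff (fun j => (c j : ℝ)) M x 0| ≤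
      ∑ n ∈ Finset.range M, |taylorCoeff (fun j => (c j : ℝ)) M x (n + 1)| * r ^ (n + 1) := by
    simpa using abs_sub_coeff_zero_le (E := 0) le_rfl hy (N := M)
      (by rw [sum_taylorCoeff_mul_pow _ M.le_succ, add_sub_cancel]; simp)
  have hlt : (∑ n ∈ Finset.range M, |((taylorCoeff c M x (n + 1) : ℚ) : ℝ)| * r ^ (n + 1)) <
      (taylorCoeff c M x 0 : ℚ) := by exact_mod_cast h
  simp only [cast_taylorCoeff] at hlt
  linarith [neg_abs_le (polyFun (fun j => (c j : ℝ)) M y -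
    taylorCoeff (fun j => (c j : ℝ)) M x 0)]

end RationalExpansion

section Transfer

variable {m : ℕ}

/-- The denominator of `cfBranch k x`, with values in an arbitrary field. -/
def cfDenom {𝕜 : Type*} [Field 𝕜] (x : 𝕜) (k : Fin m) : 𝕜 := k + 1 + x

theorem cfDenom_pos {x : ℝ} (hx : 0 < x) (k : Fin m) : 0 < cfDenom x k := by
  unfold cfDenom
  positivity

theorem cfDenom_add_sub (x y : ℝ) (k : Fin m) : cfDenom x k + (y - x) = cfDenom y k := by
  rw [cfDenom, cfDenom, add_assoc, add_sub_cancel]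

theorem one_add_sub_div_cfDenom_pos {x y : ℝ} (hx : 0 < x) (hy : 0 < y) (k : Fin m) :
    0 < 1 + (y - x) / cfDenom x k := by
  rw [one_add_div (cfDenom_pos hx k).ne', cfDenom_add_sub]
  exact div_pos (cfDenom_pos hy k) (cfDenom_pos hx k)

theorem transfer_cfBranch_eq_sum (s : ℝ) (f : ℝ → ℝ) {x y : ℝ} (hx : 0 < x) (hy : 0 < y) :
    transfer (cfBranch (m := m)) cfWeight s f y =
      ∑ k : Fin m, cfDenom x k ^ (-(2 * s)) *
        ((1 + (y - x) / cfDenom x k) ^ (-(2 * s)) * f (cfBranch k y)) := by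
  refine Finset.sum_congr rfl fun k _ => ?_
  have hxk := cfDenom_pos hx k
  have hyk := cfDenom_pos hy k
  have hweight : cfWeight k y ^ s = cfDenom y k ^ (-(2 * s)) := by
    rw [Real.rpow_neg hyk.le, Real.rpow_mul hyk.le, Real.rpow_two,
      ← Real.inv_rpow (sq_nonneg _), ← inv_pow]
    rfl
  rw [← mul_assoc, ← Real.mul_rpow hxk.le (one_add_sub_div_cfDenom_pos hx hy k).le, hweight,
    mul_one_add, mul_div_cancel₀ _ hxk.ne', cfDenom_add_sub]

variable {c : ℕ → ℚ} {M N : ℕ} {s x r : ℚ} {W : Fin m → ℚ} {y : ℝ}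

theorem abs_polyFun_sub_sum_sub_gapCoeff_le (hMN : M ≤ N + 1) (hs : 1 ≤ 2 * s) (hx : 0 < x)
    (hN : 2 * (2 * s + M + (N + 1)) * r ≤ (N + 2) * (1 + x)) (hW : ∀ k, 0 ≤ W k)
    (hy : |y - x| ≤ r) :
    |(polyFun (fun j => (c j : ℝ)) M y -
        ∑ k, W k * ((1 + (y - x) / cfDenom (x : ℝ) k) ^ (-(2 * s) : ℝ) *
          polyFun (fun j => (c j : ℝ)) M (cfBranch k y))) -
      (gapCoeff c M x (2 * s) W (cfDenom x) 0 : ℚ)| ≤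
      (gapOscillation c M x (2 * s) W (cfDenom x) r N : ℚ) := by
  have hcast (k : Fin m) : ((cfDenom x k : ℚ) : ℝ) = cfDenom (x : ℝ) k := by simp [cfDenom]
  have hx' : (0 : ℝ) < x := by exact_mod_cast hx
  have hN' : (2 * (2 * s + M + (N + 1)) * r : ℝ) ≤ (N + 2) * (1 + x) := by exact_mod_cast hN
  have hgap := abs_sub_gapCoeff_zero_le (fun j => (c j : ℝ)) hMN x (q := 2 * s)
    (W := fun k => (W k : ℝ)) (a := cfDenom (x : ℝ)) (by exact_mod_cast hs)
    (fun k => by exact_mod_cast hW k) (cfDenom_pos hx')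
    (fun k => hN'.trans (by unfold cfDenom; gcongr; simp)) hy
  simp only [add_sub_cancel, cfDenom_add_sub] at hgap
  simp only [cast_gapCoeff, cast_gapOscillation, hcast, Rat.cast_mul, Rat.cast_ofNat]
  exact hgap

theorem transfer_polyFun_le (hMN : M ≤ N + 1) (hs : 1 ≤ 2 * s) (hx : 0 < x)
    (hN : 2 * (2 * s + M + (N + 1)) * r ≤ (N + 2) * (1 + x))
    (hW : ∀ k, cfDenom (x : ℝ) k ^ (-(2 * s) : ℝ) ≤ W k)
    (hgap : gapOscillation c M x (2 * s) W (cfDenom x) r N ≤ gapCoeff c M x (2 * s) W (cfDenom x) 0)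
    (hy0 : 0 < y) (hy : |y - x| ≤ r)
    (hf : ∀ k : Fin m, 0 ≤ polyFun (fun j => (c j : ℝ)) M (cfBranch k y)) :
    transfer (cfBranch (m := m)) cfWeight s (polyFun (fun j => (c j : ℝ)) M) y ≤
      polyFun (fun j => (c j : ℝ)) M y := by
  have hx' : (0 : ℝ) < x := by exact_mod_cast hx
  have hW0 (k : Fin m) : 0 ≤ W k := by
    exact_mod_cast (Real.rpow_nonneg (cfDenom_pos hx' k).le _).trans (hW k)
  have hosc := abs_polyFun_sub_sum_sub_gapCoeff_le (c := c) hMN hs hx hN hW0 hy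
  have hgap' : ((gapOscillation c M x (2 * s) W (cfDenom x) r N : ℚ) : ℝ) ≤
      (gapCoeff c M x (2 * s) W (cfDenom x) 0 : ℚ) := by exact_mod_cast hgap
  rw [transfer_cfBranch_eq_sum _ _ hx' hy0]
  calc _ ≤ ∑ k, W k * ((1 + (y - x) / cfDenom (x : ℝ) k) ^ (-(2 * s) : ℝ) *
        polyFun (fun j => (c j : ℝ)) M (cfBranch k y)) :=
        Finset.sum_le_sum fun k _ => mul_le_mul_of_nonneg_right (hW k) <|
          mul_nonneg (Real.rpow_nonneg (one_add_sub_div_cfDenom_pos hx' hy0 k).le _) (hf k)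
    _ ≤ _ := by linarith [(abs_le.1 hosc).1]

theorem le_transfer_polyFun (hMN : M ≤ N + 1) (hs : 1 ≤ 2 * s) (hx : 0 < x)
    (hN : 2 * (2 * s + M + (N + 1)) * r ≤ (N + 2) * (1 + x)) (hW0 : ∀ k, 0 ≤ W k)
    (hW : ∀ k, W k ≤ cfDenom (x : ℝ) k ^ (-(2 * s) : ℝ))
    (hgap : gapOscillation c M x (2 * s) W (cfDenom x) r N ≤
      -gapCoeff c M x (2 * s) W (cfDenom x) 0)
    (hy0 : 0 < y) (hy : |y - x| ≤ r)
    (hf : ∀ k : Fin m, 0 ≤ polyFun (fun j => (c j : ℝ)) M (cfBranch k y)) :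
    polyFun (fun j => (c j : ℝ)) M y ≤
      transfer (cfBranch (m := m)) cfWeight s (polyFun (fun j => (c j : ℝ)) M) y := by
  have hx' : (0 : ℝ) < x := by exact_mod_cast hx
  have hosc := abs_polyFun_sub_sum_sub_gapCoeff_le (c := c) hMN hs hx hN hW0 hy
  have hgap' : ((gapOscillation c M x (2 * s) W (cfDenom x) r N : ℚ) : ℝ) ≤
      -(gapCoeff c M x (2 * s) W (cfDenom x) 0 : ℚ) := by exact_mod_cast hgap
  rw [transfer_cfBranch_eq_sum _ _ hx' hy0]
  calc _ ≤ ∑ k, W k * ((1 + (y - x) / cfDenom (x : ℝ) k) ^ (-(2 * s) : ℝ) *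
        polyFun (fun j => (c j : ℝ)) M (cfBranch k y)) := by linarith [(abs_le.1 hosc).2]
    _ ≤ _ := Finset.sum_le_sum fun k _ => mul_le_mul_of_nonneg_right (hW k) <|
        mul_nonneg (Real.rpow_nonneg (one_add_sub_div_cfDenom_pos hx' hy0 k).le _) (hf k)

end Transfer

section LogBounds

/-- A rational lower bound for `Real.log x` when `1 ≤ x`, from `n` terms of the series of
`2 * artanh ((x - 1) / (x + 1))`. -/
def logLower (n : ℕ) (x : ℚ) : ℚ :=
  2 * ∑ i ∈ Finset.range n, ((x - 1) / (x + 1)) ^ (2 * i + 1) / (2 * i + 1)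

/-- A rational upper bound for `Real.log x` when `1 ≤ x`: the remainder of the series truncated in
`logLower` is dominated by a geometric series. -/
def logUpper (n : ℕ) (x : ℚ) : ℚ :=
  logLower n x + 2 * (((x - 1) / (x + 1)) ^ (2 * n + 1) / (1 - ((x - 1) / (x + 1)) ^ 2))

theorem logLower_le_log_le_logUpper (n : ℕ) {x : ℚ} (hx : 1 ≤ x) :
    logLower n x ≤ Real.log x ∧ Real.log x ≤ logUpper n x := by
  have hx' : (1 : ℝ) ≤ x := by exact_mod_cast hx
  have hz : (0 : ℝ) ≤ (x - 1) / (x + 1) := div_nonneg (by linarith) (by linarith)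
  have hz_lt : ((x : ℝ) - 1) / (x + 1) < 1 := (div_lt_one (by linarith)).2 (by linarith)
  have hquot : (1 + ((x : ℝ) - 1) / (x + 1)) / (1 - (x - 1) / (x + 1)) = x := by
    have : (x : ℝ) + 1 ≠ 0 := by positivity
    field_simp
    ring
  have hlower := Real.sum_range_le_log_div hz hz_lt n
  have hupper := Real.log_div_le_sum_range_add hz hz_lt n
  rw [hquot] at hlower hupper
  constructor
  · rw [logLower]
    push_cast
    linarith
  · rw [logUpper, logLower]
    push_cast
    linarith

variable {q a W : ℚ} {n : ℕ}

/-- Multiplying by `a ^ 2` makes the arguments of all logarithms at least `1`, as `logLower` and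
`logUpper` require. -/
theorem rpow_neg_le_of_logUpper_le (hq : q ≤ 2) (ha : 1 ≤ a) (hW : 1 ≤ W * a ^ 2)
    (h : (2 - q) * logUpper n a ≤ logLower n (W * a ^ 2)) : (a : ℝ) ^ (-q : ℝ) ≤ W := by
  have ha' : (0 : ℝ) < a := by exact_mod_cast zero_lt_one.trans_le ha
  have hlog : (2 - q) * Real.log a ≤ Real.log (W * a ^ 2) := by
    have hle : ((2 - q) * logUpper n a : ℝ) ≤ logLower n (W * a ^ 2) := by exact_mod_cast h
    have hlogW := (logLower_le_log_le_logUpper n hW).1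
    have hq' : (0 : ℝ) ≤ 2 - q := by exact_mod_cast sub_nonneg.2 hq
    push_cast at hlogW
    exact (mul_le_mul_of_nonneg_left (logLower_le_log_le_logUpper n ha).2 hq').trans
      (hle.trans hlogW)
  have hWa : (0 : ℝ) < W * a ^ 2 := by exact_mod_cast zero_lt_one.trans_le hW
  have hrpow : (a : ℝ) ^ (2 - q : ℝ) ≤ W * a ^ 2 := by
    rwa [← Real.log_le_log_iff (by positivity) hWa, Real.log_rpow ha']
  rw [sub_eq_neg_add, Real.rpow_add ha', Real.rpow_two] at hrpow
  exact le_of_mul_le_mul_right hrpow (by positivity)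

theorem le_rpow_neg_of_logUpper_le (hq : q ≤ 2) (ha : 1 ≤ a) (hW : 1 ≤ W * a ^ 2)
    (h : logUpper n (W * a ^ 2) ≤ (2 - q) * logLower n a) : W ≤ (a : ℝ) ^ (-q : ℝ) := by
  have ha' : (0 : ℝ) < a := by exact_mod_cast zero_lt_one.trans_le ha
  have hlog : Real.log (W * a ^ 2) ≤ (2 - q) * Real.log a := by
    have hle : (logUpper n (W * a ^ 2) : ℝ) ≤ (2 - q) * logLower n a := by exact_mod_cast h
    have hlogW := (logLower_le_log_le_logUpper n hW).2
    have hq' : (0 : ℝ) ≤ 2 - q := by exact_mod_cast sub_nonneg.2 hq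
    push_cast at hlogW
    exact hlogW.trans (hle.trans
      (mul_le_mul_of_nonneg_left (logLower_le_log_le_logUpper n ha).1 hq'))
  have hWa : (0 : ℝ) < W * a ^ 2 := by exact_mod_cast zero_lt_one.trans_le hW
  have hrpow : W * (a : ℝ) ^ 2 ≤ a ^ (2 - q : ℝ) := by
    rwa [← Real.log_le_log_iff hWa (by positivity), Real.log_rpow ha']
  rw [sub_eq_neg_add, Real.rpow_add ha', Real.rpow_two] at hrpow
  exact le_of_mul_le_mul_right hrpow (by positivity)

end LogBounds

section Certificate

/-- Scaled coefficients of an approximate eigenfunction of the transfer operator of the branches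
`cfBranch k`, `k < 6`, at the exponent `s` where its spectral radius is `1`. -/
def eigenCoeffs : List ℤ :=
  [145651897867646, -129176791798628, 107401879441855, -90052623737269, 76217878111076,
    -64879090223217, 55421182762661, -47454854356791, 40704848770813, -34956923202338,
    30028123097083, -25744247682727, 21923581910481, -18378341770822, 14948773781400,
    -11567397956435, 8314842558138, -5407661059087, 3093518745684, -1509449608636, 606044854090,
    -191130652585, 44212695622, -6650246021, 486975494]

/-- `eigenCoeffs` as a sequence, extended by zero. -/
def eigenCoeff (j : ℕ) : ℚ := eigenCoeffs.getD j 0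

/-- The approximate eigenfunction with coefficients `eigenCoeffs`. -/
noncomputable def eigenPoly : ℝ → ℝ := polyFun (fun j => (eigenCoeff j : ℝ)) 25

/-- The lower end of the enclosure of the dimension of `cantorE 6`. -/
def lowerExponent : ℚ := 0.86761917324015 - 10 ^ (-13 : ℤ)

/-- The upper end of the enclosure of the dimension of `cantorE 6`. -/
def upperExponent : ℚ := 0.86761917324015 + 10 ^ (-13 : ℤ)

/-- Lower bounds for `cfDenom (1 / 2) k ^ (-(2 * lowerExponent))`. -/
def lowerWeight (k : Fin 6) : ℚ :=
  ![4948113977081629, 2039291163335666, 1137397492172343, 735394872918541, 519151688530754,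
    388509435918637] k / 10 ^ 16

/-- Upper bounds for `cfDenom (1 / 2) k ^ (-(2 * upperExponent))`. -/
def upperWeight (k : Fin 6) : ℚ :=
  ![4948113977080828, 2039291163334920, 1137397492171774, 735394872918099, 519151688530401,
    388509435918348] k / 10 ^ 16

theorem lowerWeight_le_rpow (k : Fin 6) :
    lowerWeight k ≤ cfDenom (1 / 2 : ℝ) k ^ (-(2 * lowerExponent) : ℝ) := by
  have hdenom : ∀ k : Fin 6, 1 ≤ cfDenom (1 / 2 : ℚ) k := by decide +kernel
  have hweight : ∀ k, 1 ≤ lowerWeight k * cfDenom (1 / 2) k ^ 2 := by decide +kernel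
  have hlog : ∀ k, logUpper 60 (lowerWeight k * cfDenom (1 / 2) k ^ 2) ≤
      (2 - 2 * lowerExponent) * logLower 60 (cfDenom (1 / 2) k) := by decide +kernel
  simpa [cfDenom] using
    le_rpow_neg_of_logUpper_le (by decide +kernel) (hdenom k) (hweight k) (hlog k)

theorem rpow_le_upperWeight (k : Fin 6) :
    cfDenom (1 / 2 : ℝ) k ^ (-(2 * upperExponent) : ℝ) ≤ upperWeight k := by
  have hdenom : ∀ k : Fin 6, 1 ≤ cfDenom (1 / 2 : ℚ) k := by decide +kernel
  have hweight : ∀ k, 1 ≤ upperWeight k * cfDenom (1 / 2) k ^ 2 := by decide +kernel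
  have hlog : ∀ k, (2 - 2 * upperExponent) * logUpper 60 (cfDenom (1 / 2) k) ≤
      logLower 60 (upperWeight k * cfDenom (1 / 2) k ^ 2) := by decide +kernel
  simpa [cfDenom] using
    rpow_neg_le_of_logUpper_le (by decide +kernel) (hdenom k) (hweight k) (hlog k)

theorem gapOscillation_lowerWeight_le :
    gapOscillation eigenCoeff 25 (1 / 2) (2 * lowerExponent) lowerWeight (cfDenom (1 / 2))
        (3 / 8) 41 ≤
      -gapCoeff eigenCoeff 25 (1 / 2) (2 * lowerExponent) lowerWeight (cfDenom (1 / 2)) 0 := by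
  decide +kernel

theorem gapOscillation_upperWeight_le :
    gapOscillation eigenCoeff 25 (1 / 2) (2 * upperExponent) upperWeight (cfDenom (1 / 2))
        (3 / 8) 41 ≤
      gapCoeff eigenCoeff 25 (1 / 2) (2 * upperExponent) upperWeight (cfDenom (1 / 2)) 0 := by
  decide +kernel

theorem abs_sub_half_le_of_mem_trapInterval {y : ℝ} (hy : y ∈ trapInterval 6) :
    |y - (1 / 2 : ℚ)| ≤ (3 / 8 : ℚ) := by
  obtain ⟨hle, hge⟩ := hy
  rw [abs_le]
  norm_num at hle hge ⊢
  constructor <;> linarith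

theorem eigenPoly_pos {y : ℝ} (hy : y ∈ trapInterval 6) : 0 < eigenPoly y :=
  polyFun_pos_of_sum_lt (by decide +kernel) (abs_sub_half_le_of_mem_trapInterval hy)

theorem continuous_eigenPoly : Continuous eigenPoly := by
  unfold eigenPoly polyFun
  fun_prop

theorem transfer_eigenPoly_le {y : ℝ} (hy : y ∈ trapInterval 6) :
    transfer (cfBranch (m := 6)) cfWeight upperExponent eigenPoly y ≤ eigenPoly y :=
  transfer_polyFun_le (by norm_num) (by decide +kernel) (by norm_num) (by decide +kernel)
    (by simpa using rpow_le_upperWeight) gapOscillation_upperWeight_le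
    (trapInterval_subset_Ioo hy).1 (abs_sub_half_le_of_mem_trapInterval hy)
    fun k => (eigenPoly_pos (mapsTo_cfBranch_trapInterval k hy)).le

theorem eigenPoly_le_transfer {y : ℝ} (hy : y ∈ trapInterval 6) :
    eigenPoly y ≤ transfer (cfBranch (m := 6)) cfWeight lowerExponent eigenPoly y :=
  le_transfer_polyFun (by norm_num) (by decide +kernel) (by norm_num) (by decide +kernel)
    (by decide +kernel) (by simpa using lowerWeight_le_rpow) gapOscillation_lowerWeight_le
    (trapInterval_subset_Ioo hy).1 (abs_sub_half_le_of_mem_trapInterval hy)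
    fun k => (eigenPoly_pos (mapsTo_cfBranch_trapInterval k hy)).le

theorem dimH_cantorE_six_le : dimH (cantorE 6) ≤ ENNReal.ofReal upperExponent := by
  refine dimH_cantorE_le continuous_eigenPoly.continuousOn
    (fun x hx => eigenPoly_pos (cantorE_subset_trapInterval hx)) fun x hx => ?_
  rw [Real.coe_toNNReal _ (by norm_num [upperExponent])]
  exact transfer_eigenPoly_le (cantorE_subset_trapInterval hx)

theorem le_dimH_cantorE_six : ENNReal.ofReal lowerExponent ≤ dimH (cantorE 6) := by
  refine le_dimH_cantorE continuous_eigenPoly.continuousOn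
    (fun x hx => eigenPoly_pos (cantorE_subset_trapInterval hx)) fun x hx => ?_
  rw [Real.coe_toNNReal _ (by norm_num [lowerExponent])]
  exact eigenPoly_le_transfer (cantorE_subset_trapInterval hx)

end Certificate

theorem mainTheorem9 :
    dimH (cantorE 6) ∈ Set.Icc
        (ENNReal.ofReal (0.86761917324015 - (10 : ℝ) ^ (-13 : ℤ)))
        (ENNReal.ofReal (0.86761917324015 + (10 : ℝ) ^ (-13 : ℤ))) ∧
      ENNReal.ofReal (19 / 22) < dimH (cantorE 6) := by
  have hlower := le_dimH_cantorE_six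
  have hupper := dimH_cantorE_six_le
  refine ⟨⟨?_, ?_⟩, lt_of_lt_of_le ?_ hlower⟩
  · simpa [lowerExponent] using hlower
  · simpa [upperExponent] using hupper
  · rw [ENNReal.ofReal_lt_ofReal_iff (by norm_num [lowerExponent])]
    norm_num [lowerExponent]
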